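/- Let $dA$ denote Lebesgue measure on $\mathbb{C}$ and $|\Omega|$ the area of a Lebesgue measurable set $\Omega\subset\mathbb{C}$. The Fock space $\mathcal{F}^2$ is the closed subspace of $L^2(\mathbb{C}, e^{-\pi|z|^2}\,dA(z))$ consisting of its entire functions, and $P$ is the orthogonal projection of $L^2(\mathbb{C}, e^{-\pi|z|^2}\,dA)$ onto $\mathcal{F}^2$. For a measurable set $\Omega\subset\mathbb{C}$ of finite area, let $T_\Omega=P\chi_\Omega:\mathcal{F}^2\to\mathcal{F}^2$ be the Toeplitz operator whose symbol is the characteristic function $\chi_\Omega$ of $\Omega$. It is compact, self-adjoint and positive; let $\lambda_1(\Omega)\ge\lambda_2(\Omega)\ge\cdots$ be its eigenvalues in decreasing order, repeated according to multiplicity. A measurable set $\Omega\subset\mathbb{C}$ is called circularly symmetric if there are $w\in\mathbb{C}$ and a measurable set $E\subset[0,\infty)$ such that $\Omega=\{z\in\mathbb{C}: |z-w|\in E\}$. Theorem. Let $\Omega\subset\mathbb{C}$ be a circularly symmetric set of finite area $|\Omega|>0$, and let $\Omega^*$ be the ball centered at the origin with $|\Omega^*|=|\Omega|$. Then, for every integer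 $n\ge1$, $$\sum_{k=1}^{n}\lambda_k(\Omega)\le\sum_{k=1}^{n}\lambda_k(\Omega^*)=n-\sum_{k=0}^{n-1}(n-k)\frac{|\Omega|^k}{k!}e^{-|\Omega|}.$$ Moreover, for every $n\ge1$, equality holds in the inequality if and only if there is $w\in\mathbb{C}$ such that the symmetric difference of $\Omega$ and $\Omega^*+w$ has measure zero. -/

import Mathlib

open MeasureTheory Set Filter Topology
open scoped ENNReal NNReal symmDiff

/-- The Gaussian measure `e^{-π|z|²} dA(z)` on the complex plane. -/
noncomputable def gaussMeasure : Measure ℂ :=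
  volume.withDensity fun z => ENNReal.ofReal (Real.exp (-Real.pi * ‖z‖ ^ 2))

theorem gaussMeasure_absolutelyContinuous : gaussMeasure ≪ (volume : Measure ℂ) :=
  withDensity_absolutelyContinuous _ _

theorem volume_restrict_ball_le (R : ℝ) :
    (volume : Measure ℂ).restrict (Metric.ball 0 R) ≤
      ENNReal.ofReal (Real.exp (Real.pi * R ^ 2)) • gaussMeasure := by
  have hm : Measurable fun z : ℂ => ENNReal.ofReal (Real.exp (-Real.pi * ‖z‖ ^ 2)) := by fun_prop
  rw [gaussMeasure, ← withDensity_smul _ hm, ← withDensity_indicator_one Metric.isOpen_ball.measurableSet]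
  refine withDensity_mono (Eventually.of_forall fun z => ?_)
  by_cases hz : z ∈ Metric.ball (0 : ℂ) R
  · have hz' : ‖z‖ < R := by simpa using hz
    simp only [hz, indicator_of_mem, Pi.one_apply, Pi.smul_apply, smul_eq_mul]
    rw [← ENNReal.ofReal_mul (Real.exp_nonneg _), ← Real.exp_add, ← ENNReal.ofReal_one]
    apply ENNReal.ofReal_le_ofReal
    apply Real.one_le_exp
    have : ‖z‖ ^ 2 ≤ R ^ 2 := by gcongr
    nlinarith [Real.pi_pos]
  · simp [hz]

theorem enorm_le_circle {G : ℂ → ℂ} (hG : Differentiable ℂ G) (r : ℝ) :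
    ENNReal.ofReal (2 * Real.pi) * ‖G 0‖ₑ ≤
      ∫⁻ θ in Ioo (-Real.pi) Real.pi, ‖G (Complex.polarCoord.symm (r, θ))‖ₑ := by
  have h := (hG.diffContOnCl (s := Metric.ball 0 |r|)).circleAverage
  have h2 : ∫ θ in Ioo (-Real.pi) Real.pi, G (Complex.polarCoord.symm (r, θ)) =
      (2 * Real.pi : ℝ) • G 0 := by
    have e : ∀ θ : ℝ, Complex.polarCoord.symm (r, θ) = circleMap 0 r θ := fun θ => by
      simp [circleMap, Complex.exp_mul_I]
    rw [← h, Real.circleAverage_def, smul_smul, mul_inv_cancel₀ (by positivity), one_smul,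
      ← integral_Ioc_eq_integral_Ioo,
      ← intervalIntegral.integral_of_le (by linarith [Real.pi_pos])]
    simp only [e]
    have hp : Function.Periodic (fun θ => G (circleMap 0 r θ)) (2 * Real.pi) :=
      (periodic_circleMap 0 r).comp G
    have := hp.intervalIntegral_add_eq (-Real.pi) 0
    rw [zero_add] at this
    rw [← this]
    congr 1
    ring
  calc ENNReal.ofReal (2 * Real.pi) * ‖G 0‖ₑ = ‖(2 * Real.pi : ℝ) • G 0‖ₑ := by
        rw [enorm_smul, Real.enorm_of_nonneg (by positivity)]
    _ ≤ _ := by rw [← h2]; exact enorm_integral_le_lintegral_enorm _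

theorem enorm_le_ball {G : ℂ → ℂ} (hG : Differentiable ℂ G) :
    ‖G 0‖ₑ ≤ ∫⁻ z in Metric.ball (0 : ℂ) 1, ‖G z‖ₑ := by
  have hc : Continuous G := hG.continuous
  have hps : Measurable fun p : ℝ × ℝ => Complex.polarCoord.symm p := by
    simp only [Complex.polarCoord_symm_apply]; fun_prop
  have h1 : ∫⁻ z in Metric.ball (0 : ℂ) 1, ‖G z‖ₑ =
      ∫⁻ r in Ioi (0:ℝ), ∫⁻ θ in Ioo (-Real.pi) Real.pi,
        ENNReal.ofReal r * (Metric.ball (0 : ℂ) 1).indicator (fun z => ‖G z‖ₑ)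
          (Complex.polarCoord.symm (r, θ)) := by
    rw [← lintegral_indicator Metric.isOpen_ball.measurableSet,
      ← Complex.lintegral_comp_polarCoord_symm, polarCoord_target, Measure.volume_eq_prod,
      ← Measure.prod_restrict, lintegral_prod]
    · rfl
    · refine Measurable.aemeasurable ?_
      refine (by fun_prop : Measurable fun p : ℝ × ℝ => ENNReal.ofReal p.1).smul ?_
      exact (hc.measurable.enorm.indicator Metric.isOpen_ball.measurableSet).comp hps
  have h2 : ∫⁻ r in Ioo (0:ℝ) 1, ENNReal.ofReal r * (ENNReal.ofReal (2 * Real.pi) * ‖G 0‖ₑ) ≤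
      ∫⁻ z in Metric.ball (0 : ℂ) 1, ‖G z‖ₑ := by
    rw [h1]
    refine le_trans ?_ (lintegral_mono_set (show Ioo (0:ℝ) 1 ⊆ Ioi 0 from fun r hr => hr.1))
    refine setLIntegral_mono' measurableSet_Ioo fun r hr => ?_
    rw [lintegral_const_mul' _ _ ENNReal.ofReal_ne_top]
    gcongr
    refine (enorm_le_circle hG r).trans (le_of_eq ?_)
    refine lintegral_congr fun θ => ?_
    rw [indicator_of_mem]
    rw [mem_ball_zero_iff, Complex.norm_polarCoord_symm, abs_of_pos hr.1]
    exact hr.2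
  refine le_trans ?_ h2
  rw [lintegral_mul_const _ (by fun_prop)]
  have h3 : ∫⁻ r in Ioo (0:ℝ) 1, ENNReal.ofReal r = ENNReal.ofReal (1/2) := by
    rw [← ofReal_integral_eq_lintegral_ofReal]
    · rw [← integral_Ioc_eq_integral_Ioo, ← intervalIntegral.integral_of_le zero_le_one]
      simp
    · exact (continuous_id.integrableOn_Icc (a := (0:ℝ)) (b := 1)).mono_set Ioo_subset_Icc_self
    · filter_upwards [ae_restrict_mem measurableSet_Ioo] with x hx using hx.1.le
  rw [h3, ← mul_assoc, ← ENNReal.ofReal_mul (by norm_num)]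
  have : (1:ℝ≥0∞) ≤ ENNReal.ofReal (1 / 2 * (2 * Real.pi)) := by
    rw [← ENNReal.ofReal_one]
    apply ENNReal.ofReal_le_ofReal
    nlinarith [Real.pi_gt_three]
  calc ‖G 0‖ₑ = 1 * ‖G 0‖ₑ := (one_mul _).symm
    _ ≤ _ := by gcongr

theorem exists_enorm_le (R : ℝ) : ∃ C : ℝ≥0∞, C ≠ ∞ ∧ ∀ G : ℂ → ℂ, Differentiable ℂ G →
    ∀ z ∈ Metric.ball (0 : ℂ) R, ‖G z‖ₑ ≤ C * eLpNorm G 2 gaussMeasure := by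
  set B := Metric.ball (0 : ℂ) (R + 1)
  have hfin : IsFiniteMeasure ((volume : Measure ℂ).restrict B) :=
    ⟨by rw [Measure.restrict_apply_univ]; exact measure_ball_lt_top⟩
  set c := ENNReal.ofReal (Real.exp (Real.pi * (R + 1) ^ 2))
  refine ⟨c ^ (1 / (2:ℝ≥0∞)).toReal * ((volume : Measure ℂ).restrict B) univ ^ (1 / (1:ℝ≥0∞).toReal - 1 / (2:ℝ≥0∞).toReal), ?_, ?_⟩
  · refine ENNReal.mul_ne_top (ENNReal.rpow_ne_top_of_nonneg (by positivity) ENNReal.ofReal_ne_top)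
      (ENNReal.rpow_ne_top_of_nonneg (by norm_num) (measure_ne_top _ _))
  intro G hG z hz
  have hz' : ‖z‖ < R := by simpa using hz
  have h0 : ‖G z‖ₑ ≤ ∫⁻ w in Metric.ball (0 : ℂ) 1, ‖G (z + w)‖ₑ := by
    simpa using enorm_le_ball (G := fun w => G (z + w)) (by fun_prop)
  have h1 : ∫⁻ w in Metric.ball (0 : ℂ) 1, ‖G (z + w)‖ₑ ≤ ∫⁻ w in B, ‖G w‖ₑ := by
    rw [← lintegral_indicator Metric.isOpen_ball.measurableSet,
      ← lintegral_indicator Metric.isOpen_ball.measurableSet,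
      ← lintegral_add_left_eq_self (B.indicator fun w => ‖G w‖ₑ) z]
    refine lintegral_mono fun w => ?_
    by_cases hw : w ∈ Metric.ball (0 : ℂ) 1
    · have : z + w ∈ B := by
        simp only [B, mem_ball_zero_iff] at hw ⊢
        linarith [norm_add_le z w]
      simp [hw, this]
    · simp [hw]
  have h2 : ∫⁻ w in B, ‖G w‖ₑ = eLpNorm G 1 (volume.restrict B) := by
    rw [eLpNorm_one_eq_lintegral_enorm]
  refine (h0.trans (h1.trans h2.le)).trans ?_
  refine (eLpNorm_le_eLpNorm_mul_rpow_measure_univ (q := 2) (by norm_num)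
    hG.continuous.aestronglyMeasurable).trans ?_
  have h3 : eLpNorm G 2 (volume.restrict B) ≤ c ^ (1 / (2:ℝ≥0∞)).toReal * eLpNorm G 2 gaussMeasure := by
    refine (eLpNorm_mono_measure G (volume_restrict_ball_le (R + 1))).trans ?_
    rw [eLpNorm_smul_measure_of_ne_top (by norm_num)]
    simp [c]
  calc _ ≤ _ := mul_le_mul_left h3 _
    _ = _ := by ring

/-- The Fock space: the square-integrable entire functions, as a subspace of
`L²(ℂ, e^{-π|z|²} dA)`. -/
noncomputable def fockSpace : Submodule ℂ (Lp ℂ 2 gaussMeasure) where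
  carrier := {f | ∃ F : ℂ → ℂ, Differentiable ℂ F ∧ f =ᵐ[gaussMeasure] F}
  zero_mem' := ⟨fun _ => 0, by fun_prop, Lp.coeFn_zero _ _ _⟩
  add_mem' := by
    rintro f g ⟨F, hF, hf⟩ ⟨G, hG, hg⟩
    exact ⟨F + G, hF.add hG, (Lp.coeFn_add f g).trans (hf.add hg)⟩
  smul_mem' := by
    rintro c f ⟨F, hF, hf⟩
    exact ⟨c • F, hF.const_smul c, (Lp.coeFn_smul c f).trans (hf.const_smul c)⟩

theorem isClosed_fockSpace : IsClosed (fockSpace : Set (Lp ℂ 2 gaussMeasure)) := by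
  refine IsSeqClosed.isClosed fun f g hf hfg => ?_
  choose F hF hfF using hf
  have hcau : ∀ R : ℝ, UniformCauchySeqOn F atTop (Metric.ball 0 R) := by
    intro R
    obtain ⟨C, hC, hb⟩ := exists_enorm_le R
    rw [Metric.uniformCauchySeqOn_iff]
    intro ε hε
    obtain ⟨δ, hδ, hδε⟩ : ∃ δ : ℝ≥0, 0 < δ ∧ δ * C < ENNReal.ofReal ε :=
      ENNReal.exists_nnreal_pos_mul_lt hC (ENNReal.ofReal_pos.2 hε).ne'
    obtain ⟨N, hN⟩ := EMetric.cauchySeq_iff.1 hfg.cauchySeq δ (by exact_mod_cast hδ)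
    refine ⟨N, fun m hm n hn z hz => ?_⟩
    rw [← edist_lt_ofReal, edist_eq_enorm_sub]
    refine (hb (F m - F n) ((hF m).sub (hF n)) z hz).trans_lt (lt_of_le_of_lt ?_ hδε)
    rw [← eLpNorm_congr_ae ((hfF m).sub (hfF n)), ← Lp.edist_def, mul_comm]
    gcongr
    exact (hN m hm n hn).le
  have hlim : ∀ z, ∃ w, Tendsto (fun n => F n z) atTop (𝓝 w) := fun z =>
    cauchySeq_tendsto_of_complete ((hcau (‖z‖ + 1)).cauchySeq (by simp))
  choose G hG using hlim
  have hloc : TendstoLocallyUniformlyOn F G atTop univ := by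
    intro u hu z _
    refine ⟨Metric.ball 0 (‖z‖ + 1), mem_nhdsWithin_of_mem_nhds
      (Metric.isOpen_ball.mem_nhds (by simp)), ?_⟩
    exact (hcau (‖z‖ + 1)).tendstoUniformlyOn_of_tendsto (fun w _ => hG w) u hu
  have hGd : Differentiable ℂ G := by
    rw [← differentiableOn_univ]
    exact hloc.differentiableOn (Eventually.of_forall fun n => (hF n).differentiableOn) isOpen_univ
  refine ⟨G, hGd, ?_⟩
  obtain ⟨φ, hφ, hae⟩ := (tendstoInMeasure_of_tendsto_Lp hfg).exists_seq_tendsto_ae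
  filter_upwards [hae, ae_all_iff.2 hfF] with z h1 h2
  refine tendsto_nhds_unique h1 ?_
  simp only [h2]
  exact (hG z).comp hφ.tendsto_atTop

instance : CompleteSpace fockSpace := isClosed_fockSpace.completeSpace_coe

theorem memLp_indicator {Ω : Set ℂ} (hΩ : NullMeasurableSet Ω volume)
    (f : Lp ℂ 2 gaussMeasure) : MemLp (Ω.indicator f) 2 gaussMeasure :=
  (Lp.memLp f).mono
    ((Lp.aestronglyMeasurable f).indicator₀ (hΩ.mono_ac gaussMeasure_absolutelyContinuous))
    (Eventually.of_forall fun z => norm_indicator_le_norm_self _ z)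

/-- Multiplication by the characteristic function `χ_Ω` of a Lebesgue measurable set, as a
bounded operator on `L²(ℂ, e^{-π|z|²} dA)`. -/
noncomputable def mulIndicator (Ω : Set ℂ) (hΩ : NullMeasurableSet Ω volume) :
    Lp ℂ 2 gaussMeasure →L[ℂ] Lp ℂ 2 gaussMeasure :=
  LinearMap.mkContinuous
    { toFun := fun f => (memLp_indicator hΩ f).toLp (Ω.indicator f)
      map_add' := fun f g => by
        rw [← MemLp.toLp_add]
        refine MemLp.toLp_congr _ _ ?_
        filter_upwards [Lp.coeFn_add f g] with z hz
        by_cases h : z ∈ Ω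
        · simpa [h] using hz
        · simp [h]
      map_smul' := fun c f => by
        rw [RingHom.id_apply, ← MemLp.toLp_const_smul]
        refine MemLp.toLp_congr _ _ ?_
        filter_upwards [Lp.coeFn_smul c f] with z hz
        by_cases h : z ∈ Ω
        · simpa [h] using hz
        · simp [h] }
    1 fun f => by
      rw [one_mul]
      refine Lp.norm_le_norm_of_ae_le ?_
      filter_upwards [(memLp_indicator hΩ f).coeFn_toLp] with z hz
      exact hz ▸ norm_indicator_le_norm_self _ z

/-- The Toeplitz operator `T_Ω = P χ_Ω : 𝓕² → 𝓕²`, where `P` is the orthogonal projection of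
`L²(ℂ, e^{-π|z|²} dA)` onto the Fock space. -/
noncomputable def toeplitz (Ω : Set ℂ) (hΩ : NullMeasurableSet Ω volume) :
    fockSpace →L[ℂ] fockSpace :=
  fockSpace.orthogonalProjectionOnto ∘L mulIndicator Ω hΩ ∘L fockSpace.subtypeL

/-- The `n`-th eigenvalue (`n ≥ 1`) of a compact positive operator `T`, the positive eigenvalues
being listed in decreasing order and repeated according to multiplicity: the largest `t > 0` such
that `T` has at least `n` eigenvalues `≥ t`, counted with multiplicity (the dimension of the sum of
the corresponding eigenspaces). It is `0` if `T` has fewer than `n` positive eigenvalues. -/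
noncomputable def decreasingEigenvalue {H : Type*} [NormedAddCommGroup H] [InnerProductSpace ℂ H]
    (T : H →L[ℂ] H) (n : ℕ) : ℝ :=
  sSup {t : ℝ | 0 < t ∧ (n : Cardinal) ≤ Module.rank ℂ
    (⨆ (s : ℝ) (_ : t ≤ s), Module.End.eigenspace (T : H →ₗ[ℂ] H) (s : ℂ) : Submodule ℂ H)}

/-- The `n`-th eigenvalue `λ_n(Ω)`, `n ≥ 1`, of the Toeplitz operator `T_Ω`. -/
noncomputable def toeplitzEigenvalue (Ω : Set ℂ) (hΩ : NullMeasurableSet Ω volume) (n : ℕ) : ℝ :=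
  decreasingEigenvalue (toeplitz Ω hΩ) n

/-- `Ω` is circularly symmetric: up to a translation it has the form `{z | |z| ∈ E}` with
`E ⊆ [0, ∞)` Lebesgue measurable. -/
def IsCircularlySymmetric (Ω : Set ℂ) : Prop :=
  ∃ (w : ℂ) (E : Set ℝ), E ⊆ Ici 0 ∧ NullMeasurableSet E volume ∧ Ω = {z | ‖z - w‖ ∈ E}

/-- The ball `Ω*` centred at the origin with the same area as `Ω` (for `Ω` of finite area). -/
noncomputable def equimeasurableBall (Ω : Set ℂ) : Set ℂ :=
  Metric.ball 0 (Real.sqrt ((volume Ω).toReal / Real.pi))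

theorem volume_equimeasurableBall {Ω : Set ℂ} (hΩ : volume Ω ≠ ∞) :
    volume (equimeasurableBall Ω) = volume Ω := by
  rw [equimeasurableBall, Complex.volume_ball, ← ENNReal.ofReal_pow (Real.sqrt_nonneg _),
    Real.sq_sqrt (by positivity), ← ENNReal.ofReal_coe_nnreal, ← ENNReal.ofReal_mul (by positivity),
    NNReal.coe_real_pi, div_mul_cancel₀ _ Real.pi_ne_zero, ENNReal.ofReal_toReal hΩ]

theorem nullMeasurableSet_equimeasurableBall (Ω : Set ℂ) :
    NullMeasurableSet (equimeasurableBall Ω) volume :=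
  Metric.isOpen_ball.measurableSet.nullMeasurableSet

/-- Two sets are equivalent if their symmetric difference is negligible. -/
def SetEquiv (Ω Ω' : Set ℂ) : Prop := volume (Ω ∆ Ω') = 0

/-! Circular symmetry about `w` makes the Toeplitz operator diagonal in the functions `(z - w)^k
e^{π w̄ z}`. With `s = π|z - w|²`, its eigenvalues become `μ_k = ∫_A s^k/k! e^{-s} ds`, where `A ⊆
(0, ∞)` is the set of areas and `|A| = |Ω|`. The `n` largest eigenvalues are the `μ_k` with `k` in
some `n`-element set `S`, so it suffices to bound `∑_{k ∈ S} μ_k` for an arbitrary finite `S`.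

Let `N_s` be a Poisson process of rate one. Since `P(N_s = k) = s^k/k! e^{-s}`, the sum `∑_{k ∈ S}
μ_k` is the expected number of jumps made at times in `A` from states in `S`. Each state is left at
most once, and the number of jumps in `A` is Poisson of mean `|A|`. The count is therefore at most
the minimum of that variable and `n`, whose expectation is `poissonMin n |A|`. For `A = (0, a)` and
`S = {0, ..., n - 1}` this is an equality, which gives the ball.

The probability is replaced by a value function. In state `j` at time `s`, the number of counted
jumps still to come is bounded by the expected minimum of the jumps left in `A` and the states of
`S` that are at least `j`; `poissonValue` averages this over `j`. It starts at `poissonMin n |A|`,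
stays nonnegative, and decreases at least as fast as `poissonRate` (`poissonRate_le_neg_deriv`),
which is the rate of counted jumps plus `poissonGap`, the cost of leaving a state of `S` outside
`A`. The gap is positive at every time in `(0, |A|)` outside `A`, so equality forces `A = (0, |A|)`
almost everywhere, and `Ω` is a ball up to a null set. -/

/-! ### Poisson weights, distribution function and truncated mean -/

/-- The Poisson weight `s ^ k / k! * e^{-s}`. -/
noncomputable def poissonWeight (k : ℕ) (s : ℝ) : ℝ := s ^ k / (k.factorial : ℝ) * Real.exp (-s)

/-- The probability that a Poisson variable of mean `s` is less than `r`. -/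
noncomputable def poissonCDF (r : ℕ) (s : ℝ) : ℝ := ∑ k ∈ Finset.range r, poissonWeight k s

/-- The expectation of `min N r`, for a Poisson variable `N` of mean `s`. -/
noncomputable def poissonMin (r : ℕ) (s : ℝ) : ℝ :=
  ∑ k ∈ Finset.range r, (1 - poissonCDF (k + 1) s)

theorem poissonWeight_nonneg (k : ℕ) {s : ℝ} (hs : 0 ≤ s) : 0 ≤ poissonWeight k s := by
  unfold poissonWeight; positivity

theorem poissonWeight_pos (k : ℕ) {s : ℝ} (hs : 0 < s) : 0 < poissonWeight k s := by
  unfold poissonWeight; positivity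

theorem poissonCDF_succ (r : ℕ) (s : ℝ) :
    poissonCDF (r + 1) s = poissonCDF r s + poissonWeight r s :=
  Finset.sum_range_succ _ _

theorem poissonMin_succ (r : ℕ) (s : ℝ) :
    poissonMin (r + 1) s = poissonMin r s + (1 - poissonCDF (r + 1) s) :=
  Finset.sum_range_succ _ _

@[simp] theorem poissonCDF_zero (s : ℝ) : poissonCDF 0 s = 0 := by simp [poissonCDF]

@[simp] theorem poissonMin_zero (s : ℝ) : poissonMin 0 s = 0 := by simp [poissonMin]

theorem poissonCDF_nonneg (r : ℕ) {s : ℝ} (hs : 0 ≤ s) : 0 ≤ poissonCDF r s :=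
  Finset.sum_nonneg fun k _ => poissonWeight_nonneg k hs

theorem poissonCDF_eq (r : ℕ) (s : ℝ) :
    poissonCDF r s = (∑ k ∈ Finset.range r, s ^ k / (k.factorial : ℝ)) * Real.exp (-s) := by
  simp only [poissonCDF, poissonWeight, Finset.sum_mul]

theorem poissonCDF_le_one (r : ℕ) {s : ℝ} (hs : 0 ≤ s) : poissonCDF r s ≤ 1 := by
  rw [poissonCDF_eq, Real.exp_neg, ← div_eq_mul_inv, div_le_one (Real.exp_pos s)]
  exact Real.sum_le_exp_of_nonneg hs r

theorem poissonCDF_lt_one (r : ℕ) {s : ℝ} (hs : 0 < s) : poissonCDF r s < 1 := by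
  have h := poissonCDF_le_one (r + 1) hs.le
  rw [poissonCDF_succ] at h
  linarith [poissonWeight_pos r hs]

theorem poissonWeight_le_one (k : ℕ) {s : ℝ} (hs : 0 ≤ s) : poissonWeight k s ≤ 1 := by
  have h := poissonCDF_le_one (k + 1) hs
  rw [poissonCDF_succ] at h
  linarith [poissonCDF_nonneg k hs]

theorem poissonMin_nonneg (r : ℕ) {s : ℝ} (hs : 0 ≤ s) : 0 ≤ poissonMin r s :=
  Finset.sum_nonneg fun _ _ => sub_nonneg.2 (poissonCDF_le_one _ hs)

theorem contDiff_poissonWeight (k : ℕ) : ContDiff ℝ 1 (poissonWeight k) := by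
  unfold poissonWeight; fun_prop

theorem contDiff_poissonCDF (r : ℕ) : ContDiff ℝ 1 (poissonCDF r) :=
  ContDiff.sum fun _ _ => contDiff_poissonWeight _

theorem contDiff_poissonMin (r : ℕ) : ContDiff ℝ 1 (poissonMin r) :=
  ContDiff.sum fun _ _ => contDiff_const.sub (contDiff_poissonCDF _)

theorem continuous_poissonWeight (k : ℕ) : Continuous (poissonWeight k) :=
  (contDiff_poissonWeight k).continuous

theorem hasDerivAt_poissonWeight_zero (s : ℝ) :
    HasDerivAt (poissonWeight 0) (-poissonWeight 0 s) s := by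
  have : poissonWeight 0 = fun s => Real.exp (-s) := by ext; simp [poissonWeight]
  rw [this]
  simpa using (hasDerivAt_neg s).exp

theorem hasDerivAt_poissonWeight_succ (k : ℕ) (s : ℝ) :
    HasDerivAt (poissonWeight (k + 1)) (poissonWeight k s - poissonWeight (k + 1) s) s := by
  have h := (((hasDerivAt_pow (k + 1) s).div_const ((k + 1).factorial : ℝ))).mul
    (hasDerivAt_neg s).exp
  refine h.congr_deriv ?_
  have : (k.factorial : ℝ) ≠ 0 := by positivity
  simp only [poissonWeight, Nat.factorial_succ]
  push_cast
  have : (k : ℝ) + 1 ≠ 0 := by positivity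
  field_simp
  ring

/-- The derivatives of the weights telescope: the only flow out of the states `0, ..., r` is the
jump from `r`. -/
theorem hasDerivAt_poissonCDF_succ (r : ℕ) (s : ℝ) :
    HasDerivAt (poissonCDF (r + 1)) (-poissonWeight r s) s := by
  induction r with
  | zero =>
    have : poissonCDF 1 = poissonWeight 0 := by ext; simp [poissonCDF]
    rw [zero_add, this]; exact hasDerivAt_poissonWeight_zero s
  | succ r ih =>
    have : poissonCDF (r + 1 + 1) = poissonCDF (r + 1) + poissonWeight (r + 1) :=
      funext fun s => poissonCDF_succ _ s
    rw [this]
    exact (ih.add (hasDerivAt_poissonWeight_succ r s)).congr_deriv (by ring)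

/-- A jump increases `min N r` exactly when `N < r`. -/
theorem hasDerivAt_poissonMin (r : ℕ) (s : ℝ) :
    HasDerivAt (poissonMin r) (poissonCDF r s) s := by
  have h := HasDerivAt.fun_sum (u := Finset.range r) fun k _ =>
    (hasDerivAt_poissonCDF_succ k s).const_sub 1
  simp only [neg_neg] at h
  exact h

theorem integral_poissonWeight (k : ℕ) (a : ℝ) :
    ∫ s in (0)..a, poissonWeight k s = 1 - poissonCDF (k + 1) a := by
  rw [intervalIntegral.integral_eq_sub_of_hasDerivAt (f := fun s => -poissonCDF (k + 1) s)
    (fun s _ => (hasDerivAt_poissonCDF_succ k s).neg.congr_deriv (by ring))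
    ((continuous_poissonWeight k).intervalIntegrable _ _)]
  have : poissonCDF (k + 1) 0 = 1 := by
    rw [poissonCDF_eq, Finset.sum_range_succ']
    simp
  rw [this]; ring

theorem poissonMin_eq (r : ℕ) (s : ℝ) :
    poissonMin r s = (r : ℝ) - ∑ k ∈ Finset.range r, ((r : ℝ) - (k : ℝ)) *
      (s ^ k / (k.factorial : ℝ)) * Real.exp (-s) := by
  induction r with
  | zero => simp
  | succ r ih =>
    rw [poissonMin_succ, ih, Finset.sum_range_succ, poissonCDF_succ, poissonCDF, poissonWeight]
    have : ∑ k ∈ Finset.range r, (((r + 1 : ℕ) : ℝ) - (k : ℝ)) * (s ^ k / (k.factorial : ℝ)) *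
        Real.exp (-s) = ∑ k ∈ Finset.range r, ((r : ℝ) - (k : ℝ)) * (s ^ k / (k.factorial : ℝ)) *
        Real.exp (-s) + ∑ k ∈ Finset.range r, poissonWeight k s := by
      rw [← Finset.sum_add_distrib]
      refine Finset.sum_congr rfl fun k _ => ?_
      rw [poissonWeight]; push_cast; ring
    rw [this]; push_cast; ring

/-- Summation by parts against the derivatives of the Poisson weights. -/
theorem sum_deriv_poissonWeight_mul (c : ℕ → ℝ) (M : ℕ) (s : ℝ) :
    ∑ j ∈ Finset.range (M + 1), deriv (poissonWeight j) s * c j =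
      ∑ j ∈ Finset.range M, poissonWeight j s * (c (j + 1) - c j) - poissonWeight M s * c M := by
  induction M with
  | zero => simp [(hasDerivAt_poissonWeight_zero s).deriv]
  | succ M ih =>
    rw [Finset.sum_range_succ, ih, (hasDerivAt_poissonWeight_succ M s).deriv,
      Finset.sum_range_succ]
    ring

/-! ### The value function and its rate of decrease -/

/-- The number of elements of `S` that are at least `j`. -/
def tailCard (S : Finset ℕ) (j : ℕ) : ℕ := (S.filter (j ≤ ·)).card

theorem tailCard_zero (S : Finset ℕ) : tailCard S 0 = S.card := by simp [tailCard]

theorem tailCard_of_mem {S : Finset ℕ} {j : ℕ} (hj : j ∈ S) :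
    tailCard S j = tailCard S (j + 1) + 1 := by
  have : S.filter (j ≤ ·) = insert j (S.filter (j + 1 ≤ ·)) := by
    ext k; simp only [Finset.mem_filter, Finset.mem_insert]; grind
  rw [tailCard, this, Finset.card_insert_of_notMem (by simp)]
  rfl

theorem tailCard_of_notMem {S : Finset ℕ} {j : ℕ} (hj : j ∉ S) :
    tailCard S j = tailCard S (j + 1) := by
  have : S.filter (j ≤ ·) = S.filter (j + 1 ≤ ·) := by
    ext k; simp only [Finset.mem_filter]; grind
  rw [tailCard, this]; rfl

theorem tailCard_eq_zero {S : Finset ℕ} {M : ℕ} (hM : S ⊆ Finset.range M) : tailCard S M = 0 := by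
  rw [tailCard, Finset.card_eq_zero, Finset.filter_eq_empty_iff]
  intro k hk
  simpa using hM hk

/-- The measure of the part of `A` beyond `s`. -/
noncomputable def remainder (A : Set ℝ) (s : ℝ) : ℝ :=
  volume.real A - ∫ x in (0)..s, A.indicator (fun _ => (1 : ℝ)) x

section remainder

variable {A : Set ℝ}

theorem intervalIntegrable_indicator_one (hA : MeasurableSet A) (a b : ℝ) :
    IntervalIntegrable (A.indicator fun _ => (1 : ℝ)) volume a b := by
  rw [intervalIntegrable_iff]
  exact (integrableOn_const (by simp)).indicator hA

theorem integral_indicator_one_eq (hA : MeasurableSet A) {s : ℝ} (hs : 0 ≤ s) :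
    ∫ x in (0)..s, A.indicator (fun _ => (1 : ℝ)) x = volume.real (A ∩ Ioc 0 s) := by
  rw [intervalIntegral.integral_of_le hs, integral_indicator hA,
    Measure.restrict_restrict hA]
  simp

theorem remainder_nonneg (hA : MeasurableSet A) (hfin : volume A ≠ ∞) {s : ℝ} (hs : 0 ≤ s) :
    0 ≤ remainder A s := by
  rw [remainder, integral_indicator_one_eq hA hs, sub_nonneg]
  exact measureReal_mono inter_subset_left hfin

theorem remainder_le {s : ℝ} (hA : MeasurableSet A) (hs : 0 ≤ s) :
    remainder A s ≤ volume.real A := by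
  rw [remainder, integral_indicator_one_eq hA hs]
  linarith [measureReal_nonneg (μ := volume) (s := A ∩ Ioc 0 s)]

theorem remainder_pos (hA : MeasurableSet A) {s : ℝ} (hs : 0 ≤ s) (hs' : s < volume.real A) :
    0 < remainder A s := by
  rw [remainder, integral_indicator_one_eq hA hs, sub_pos]
  refine lt_of_le_of_lt ?_ hs'
  refine (measureReal_mono (inter_subset_right) (by simp)).trans ?_
  simp [hs]

theorem ae_hasDerivAt_remainder (hA : MeasurableSet A) :
    ∀ᵐ s, HasDerivAt (remainder A) (-A.indicator (fun _ => (1 : ℝ)) s) s := by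
  have : LocallyIntegrable (A.indicator fun _ => (1 : ℝ)) volume :=
    (locallyIntegrable_const 1).indicator hA
  filter_upwards [LocallyIntegrable.ae_hasDerivAt_integral this] with s hs
  exact (hs 0).const_sub _

theorem lipschitzWith_remainder (hA : MeasurableSet A) : LipschitzWith 1 (remainder A) := by
  refine LipschitzWith.of_dist_le_mul fun x y => ?_
  rw [remainder, remainder, dist_sub_left, Real.dist_eq, Real.dist_eq,
    intervalIntegral.integral_interval_sub_left (intervalIntegrable_indicator_one hA _ _)
      (intervalIntegrable_indicator_one hA _ _)]
  have := intervalIntegral.norm_integral_le_of_norm_le_const (a := y) (b := x) (C := 1)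
    (f := A.indicator fun _ => (1 : ℝ)) (fun t _ => by
      by_cases h : t ∈ A <;> simp [h])
  simpa using this

/-- The remainder is differentiable only almost everywhere, so the fundamental theorem of calculus
is applied through absolute continuity. The remainder is 1-Lipschitz with values in the compact
interval `[0, |A|]`, on which the smooth function `poissonMin r` is Lipschitz. -/
theorem absolutelyContinuous_poissonMin_remainder (hA : MeasurableSet A) (hfin : volume A ≠ ∞)
    (r : ℕ) {T : ℝ} (hT : 0 ≤ T) :
    AbsolutelyContinuousOnInterval (fun s => poissonMin r (remainder A s)) 0 T := by
  obtain ⟨K, hK⟩ := (contDiff_poissonMin r).contDiffOn (s := Icc 0 (volume.real A))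
    |>.exists_lipschitzOnWith (by decide) (convex_Icc _ _) isCompact_Icc
  refine (hK.comp (lipschitzWith_remainder hA).lipschitzOnWith fun s hs => ?_)
    |>.absolutelyContinuousOnInterval
  rw [uIcc_of_le hT] at hs
  exact ⟨remainder_nonneg hA hfin hs.1, remainder_le hA hs.1⟩

/-- The conditional expectation at time `s` of the optimal number of counted jumps. -/
noncomputable def poissonValue (A : Set ℝ) (S : Finset ℕ) (M : ℕ) (s : ℝ) : ℝ :=
  ∑ j ∈ Finset.range M, poissonWeight j s * poissonMin (tailCard S j) (remainder A s)

theorem absolutelyContinuous_poissonValue (hA : MeasurableSet A) (hfin : volume A ≠ ∞)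
    (S : Finset ℕ) (M : ℕ) {T : ℝ} (hT : 0 ≤ T) :
    AbsolutelyContinuousOnInterval (poissonValue A S M) 0 T := by
  unfold poissonValue
  induction M with
  | zero =>
    simp only [Finset.range_zero, Finset.sum_empty]
    exact contDiffOn_const.absolutelyContinuousOnInterval
  | succ M ih =>
    simp only [Finset.sum_range_succ]
    exact ih.add ((contDiff_poissonWeight M).contDiffOn.absolutelyContinuousOnInterval.mul
      (absolutelyContinuous_poissonMin_remainder hA hfin _ hT))

/-- The rate at which `poissonValue` decreases, up to a nonnegative term. -/
noncomputable def poissonRate (A : Set ℝ) (S : Finset ℕ) (s : ℝ) : ℝ :=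
  ∑ j ∈ S, poissonWeight j s *
    (1 - (1 - A.indicator (fun _ => (1 : ℝ)) s) * poissonCDF (tailCard S j) (remainder A s))

/-- Summation by parts turns the time derivative into a sum over jumps `j → j + 1`. If `j ∈ S`, one
available state is used up, and the change in `poissonMin` combines with the shrinking of the
remainder to give exactly the term of `poissonRate`. -/
theorem poissonRate_le_neg_deriv (hA : MeasurableSet A) (hfin : volume A ≠ ∞) {S : Finset ℕ}
    {M : ℕ} (hM : S ⊆ Finset.range M) {s : ℝ} (hs : 0 ≤ s)
    (hd : HasDerivAt (remainder A) (-A.indicator (fun _ => (1 : ℝ)) s) s) :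
    poissonRate A S s ≤ -deriv (poissonValue A S (M + 1)) s := by
  set χ := A.indicator (fun _ => (1 : ℝ)) s with hχ
  have hχ0 : 0 ≤ χ := indicator_nonneg (fun _ _ => zero_le_one) _
  have h1 : HasDerivAt (poissonValue A S (M + 1)) (∑ j ∈ Finset.range (M + 1),
      (deriv (poissonWeight j) s * poissonMin (tailCard S j) (remainder A s) +
        poissonWeight j s * (poissonCDF (tailCard S j) (remainder A s) * -χ))) s := by
    unfold poissonValue
    refine HasDerivAt.fun_sum fun j _ => ?_
    exact ((contDiff_poissonWeight j).differentiable one_ne_zero s).hasDerivAt.mul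
      ((hasDerivAt_poissonMin _ _).comp s hd)
  -- The extra index `M` lies above all of `S`; there no state remains, so the boundary term of the
  -- summation by parts vanishes.
  rw [h1.deriv, Finset.sum_add_distrib,
    sum_deriv_poissonWeight_mul (fun j => poissonMin (tailCard S j) (remainder A s)),
    Finset.sum_range_succ, tailCard_eq_zero hM, poissonRate]
  simp only [poissonMin_zero, poissonCDF_zero, mul_zero, zero_mul, sub_zero, add_zero]
  rw [← Finset.sum_add_distrib, ← Finset.sum_neg_distrib, ← Finset.inter_eq_right.2 hM,
    ← Finset.sum_ite_mem, Finset.inter_eq_right.2 hM]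
  refine Finset.sum_le_sum fun j _ => ?_
  split_ifs with hj
  · rw [tailCard_of_mem hj, poissonMin_succ]
    refine le_of_eq ?_
    ring
  -- Time in `A` spent in a state outside `S` is wasted: this loss is nonnegative and is dropped.
  · rw [tailCard_of_notMem hj, sub_self, mul_zero, zero_add]
    have h2 := poissonWeight_nonneg j hs
    have h3 := poissonCDF_nonneg (tailCard S (j + 1)) (remainder_nonneg hA hfin hs)
    have : 0 ≤ poissonWeight j s * (poissonCDF (tailCard S (j + 1)) (remainder A s) * χ) := by
      positivity
    linarith

theorem intervalIntegrable_poissonRate (hA : MeasurableSet A) (S : Finset ℕ) (T : ℝ) :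
    IntervalIntegrable (poissonRate A S) volume 0 T := by
  unfold poissonRate
  refine IntervalIntegrable.sum S (f := fun j s => poissonWeight j s *
    (1 - (1 - A.indicator (fun _ => (1 : ℝ)) s) * poissonCDF (tailCard S j) (remainder A s)))
    (fun j _ => ?_) |>.congr fun s _ => by simp
  have hc : Continuous fun s => poissonCDF (tailCard S j) (remainder A s) :=
    (contDiff_poissonCDF _).continuous.comp (lipschitzWith_remainder hA).continuous
  have h1 : IntervalIntegrable (fun s => 1 - A.indicator (fun _ => (1 : ℝ)) s) volume 0 T :=
    intervalIntegrable_const.sub (intervalIntegrable_indicator_one hA _ _)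
  exact (intervalIntegrable_const.sub (h1.mul_continuousOn hc.continuousOn)).continuousOn_mul
    (continuous_poissonWeight j).continuousOn

theorem integral_poissonRate_le (hA : MeasurableSet A) (hfin : volume A ≠ ∞) (S : Finset ℕ)
    {T : ℝ} (hT : 0 ≤ T) :
    ∫ s in (0)..T, poissonRate A S s ≤ poissonMin S.card (volume.real A) := by
  obtain ⟨M, hM⟩ := S.exists_nat_subset_range
  have hac := absolutelyContinuous_poissonValue hA hfin S (M + 1) hT
  have h1 : ∫ s in (0)..T, poissonRate A S s ≤
      ∫ s in (0)..T, -deriv (poissonValue A S (M + 1)) s := by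
    refine intervalIntegral.integral_mono_ae_restrict hT (intervalIntegrable_poissonRate hA S T)
      hac.intervalIntegrable_deriv.neg ?_
    filter_upwards [ae_restrict_mem measurableSet_Icc,
      ae_restrict_of_ae (ae_hasDerivAt_remainder hA)] with s hs hd
    exact poissonRate_le_neg_deriv hA hfin hM hs.1 hd
  rw [intervalIntegral.integral_neg, hac.integral_deriv_eq_sub] at h1
  have h2 : 0 ≤ poissonValue A S (M + 1) T := Finset.sum_nonneg fun j _ =>
    mul_nonneg (poissonWeight_nonneg j hT) (poissonMin_nonneg _ (remainder_nonneg hA hfin hT))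
  have h3 : poissonValue A S (M + 1) 0 = poissonMin S.card (volume.real A) := by
    rw [poissonValue, Finset.sum_range_succ', ← tailCard_zero]
    simp [poissonWeight, remainder]
  linarith

/-- The part of `poissonRate` living outside `A`. -/
noncomputable def poissonGap (A : Set ℝ) (S : Finset ℕ) (s : ℝ) : ℝ :=
  (1 - A.indicator (fun _ => (1 : ℝ)) s) *
    ∑ j ∈ S, poissonWeight j s * (1 - poissonCDF (tailCard S j) (remainder A s))

theorem poissonRate_eq (A : Set ℝ) (S : Finset ℕ) (s : ℝ) :
    poissonRate A S s = A.indicator (fun s => ∑ j ∈ S, poissonWeight j s) s + poissonGap A S s := by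
  rw [poissonRate, poissonGap]
  by_cases h : s ∈ A <;> simp [h]

theorem poissonGap_nonneg (hA : MeasurableSet A) (hfin : volume A ≠ ∞) (S : Finset ℕ) {s : ℝ}
    (hs : 0 ≤ s) : 0 ≤ poissonGap A S s := by
  refine mul_nonneg ?_ (Finset.sum_nonneg fun j _ => mul_nonneg (poissonWeight_nonneg j hs)
    (sub_nonneg.2 (poissonCDF_le_one _ (remainder_nonneg hA hfin hs))))
  by_cases h : s ∈ A <;> simp [h]

/-- Before time `|A|` some of `A` is still to come, so each Poisson distribution function in the gap
is strictly below one. -/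
theorem mem_of_poissonGap_eq_zero (hA : MeasurableSet A) {S : Finset ℕ}
    (hS : S.Nonempty) {s : ℝ} (hs : 0 < s) (hs' : s < volume.real A)
    (h : poissonGap A S s = 0) : s ∈ A := by
  by_contra hsA
  have : 0 < ∑ j ∈ S, poissonWeight j s * (1 - poissonCDF (tailCard S j) (remainder A s)) :=
    Finset.sum_pos (fun j _ => mul_pos (poissonWeight_pos j hs)
      (sub_pos.2 (poissonCDF_lt_one _ (remainder_pos hA hs.le hs')))) hS
  simp [poissonGap, hsA, this.ne'] at h

end remainder

/-! ### The sharp bound for sums of Poisson masses, and its equality case -/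

/-- The integral of the `k`-th Poisson weight over `A`. -/
noncomputable def poissonMass (A : Set ℝ) (k : ℕ) : ℝ := ∫ s in A, poissonWeight k s

section mass

variable {A : Set ℝ}

theorem integrableOn_poissonWeight (hA : MeasurableSet A) (hA0 : A ⊆ Ioi 0)
    (hfin : volume A ≠ ∞) (k : ℕ) : IntegrableOn (poissonWeight k) A := by
  refine IntegrableOn.of_bound hfin.lt_top
    (continuous_poissonWeight k).aestronglyMeasurable 1 ?_
  filter_upwards [ae_restrict_mem hA] with s hs
  have hs0 : (0 : ℝ) ≤ s := (hA0 hs).le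
  rw [Real.norm_of_nonneg (poissonWeight_nonneg k hs0)]
  exact poissonWeight_le_one k hs0

theorem tendsto_integral_indicator_poissonWeight (hA : MeasurableSet A) (hA0 : A ⊆ Ioi 0)
    (hfin : volume A ≠ ∞) (S : Finset ℕ) :
    Tendsto (fun T : ℝ => ∫ s in (0)..T, A.indicator (fun s => ∑ j ∈ S, poissonWeight j s) s)
      atTop (𝓝 (∑ k ∈ S, poissonMass A k)) := by
  have hint : IntegrableOn (fun s => ∑ j ∈ S, poissonWeight j s) A :=
    integrable_finsetSum S fun k _ => integrableOn_poissonWeight hA hA0 hfin k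
  have h := intervalIntegral_tendsto_integral_Ioi 0
    ((integrable_indicator_iff hA).2 hint).integrableOn tendsto_id
  rwa [setIntegral_indicator hA, inter_eq_right.2 hA0, integral_finsetSum S
    fun k _ => integrableOn_poissonWeight hA hA0 hfin k] at h

theorem intervalIntegrable_indicator_poissonWeight (hA : MeasurableSet A) (S : Finset ℕ) (T : ℝ) :
    IntervalIntegrable (A.indicator fun s => ∑ j ∈ S, poissonWeight j s) volume 0 T := by
  have hc : Continuous fun s => ∑ j ∈ S, poissonWeight j s :=
    continuous_finsetSum S fun j _ => continuous_poissonWeight j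
  have := hc.intervalIntegrable (μ := volume) 0 T
  rw [intervalIntegrable_iff] at this ⊢
  exact this.indicator hA

theorem intervalIntegrable_poissonGap (hA : MeasurableSet A) (S : Finset ℕ) (T : ℝ) :
    IntervalIntegrable (poissonGap A S) volume 0 T := by
  refine ((intervalIntegrable_poissonRate hA S T).sub
    (intervalIntegrable_indicator_poissonWeight hA S T)).congr fun s _ => ?_
  simp [poissonRate_eq]

/-- Keeping the gap when `poissonRate` is integrated gives a quantitative deficit: `T = 0` yields
the inequality, `T = |A|` the equality case. -/
theorem integral_poissonGap_le (hA : MeasurableSet A) (hA0 : A ⊆ Ioi 0) (hfin : volume A ≠ ∞)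
    (S : Finset ℕ) {T : ℝ} (hT : 0 ≤ T) :
    ∫ s in (0)..T, poissonGap A S s ≤
      poissonMin S.card (volume.real A) - ∑ k ∈ S, poissonMass A k := by
  -- The integral of the rate is bounded up to `T + |t|`, which is at least `T` for every `t`, and
  -- then `t` tends to infinity.
  refine ge_of_tendsto' (tendsto_const_nhds.sub
    ((tendsto_integral_indicator_poissonWeight hA hA0 hfin S).comp
      (tendsto_atTop_add_const_left atTop T tendsto_abs_atTop_atTop))) fun t => ?_
  have hT' : T ≤ T + |t| := le_add_of_nonneg_right (abs_nonneg t)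
  have h1 := integral_poissonRate_le hA hfin S (hT.trans hT')
  simp only [poissonRate_eq] at h1
  rw [intervalIntegral.integral_add (intervalIntegrable_indicator_poissonWeight hA S _)
    (intervalIntegrable_poissonGap hA S _)] at h1
  have h2 : ∫ s in (0)..T, poissonGap A S s ≤ ∫ s in (0)..(T + |t|), poissonGap A S s := by
    refine intervalIntegral.integral_mono_interval le_rfl hT hT' ?_
      (intervalIntegrable_poissonGap hA S _)
    filter_upwards [ae_restrict_mem measurableSet_Ioc] with s hs
    exact poissonGap_nonneg hA hfin S hs.1.le
  simp only [Function.comp]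
  linarith

theorem sum_poissonMass_le (hA : MeasurableSet A) (hA0 : A ⊆ Ioi 0) (hfin : volume A ≠ ∞)
    (S : Finset ℕ) : ∑ k ∈ S, poissonMass A k ≤ poissonMin S.card (volume.real A) := by
  have := integral_poissonGap_le hA hA0 hfin S le_rfl
  rw [intervalIntegral.integral_same] at this
  linarith

theorem ae_mem_of_sum_poissonMass_eq (hA : MeasurableSet A) (hA0 : A ⊆ Ioi 0)
    (hfin : volume A ≠ ∞) {S : Finset ℕ} (hS : S.Nonempty)
    (h : ∑ k ∈ S, poissonMass A k = poissonMin S.card (volume.real A)) :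
    A =ᵐ[volume] Ioo 0 (volume.real A) := by
  set a := volume.real A with ha
  have ha0 : 0 ≤ a := measureReal_nonneg
  have h1 := integral_poissonGap_le hA hA0 hfin S ha0
  rw [h, sub_self, intervalIntegral.integral_of_le ha0] at h1
  have h0 : 0 ≤ᵐ[volume.restrict (Ioc 0 a)] poissonGap A S := by
    filter_upwards [ae_restrict_mem measurableSet_Ioc] with s hs
    exact poissonGap_nonneg hA hfin S hs.1.le
  have h2 := (setIntegral_eq_zero_iff_of_nonneg_ae h0
    ((intervalIntegrable_iff_integrableOn_Ioc_of_le ha0).1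
      (intervalIntegrable_poissonGap hA S a))).1 (h1.antisymm (integral_nonneg_of_ae h0))
  have h3 : (Ioo 0 a : Set ℝ) ≤ᵐ[volume] A := by
    filter_upwards [(ae_restrict_iff' measurableSet_Ioc).1 h2] with s hs hsa
    exact mem_of_poissonGap_eq_zero hA hS hsa.1 hsa.2 (hs ⟨hsa.1, hsa.2.le⟩)
  -- The interval is almost contained in `A` and has the same finite measure, so nothing of `A` is
  -- left over.
  refine (ae_eq_of_ae_subset_of_measure_ge h3 ?_ measurableSet_Ioo.nullMeasurableSet hfin).symm
  rw [Real.volume_Ioo, sub_zero, ha, Measure.real, ENNReal.ofReal_toReal hfin]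

theorem poissonMass_pos (hA : MeasurableSet A) (hA0 : A ⊆ Ioi 0) (hfin : volume A ≠ ∞)
    (hpos : 0 < volume A) (k : ℕ) : 0 < poissonMass A k := by
  rw [poissonMass, setIntegral_pos_iff_support_of_nonneg_ae]
  · rwa [inter_eq_right.2]
    exact fun s hs => (poissonWeight_pos k (hA0 hs)).ne'
  · filter_upwards [ae_restrict_mem hA] with s hs
    exact poissonWeight_nonneg k (hA0 hs).le
  · exact integrableOn_poissonWeight hA hA0 hfin k

theorem tendsto_poissonMass (hA : MeasurableSet A) (hA0 : A ⊆ Ioi 0) (hfin : volume A ≠ ∞) :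
    Tendsto (poissonMass A) atTop (𝓝 0) := by
  have h := tendsto_integral_of_dominated_convergence (μ := volume.restrict A)
    (F := poissonWeight) (f := fun _ => 0) (fun _ => 1)
    (fun k => (continuous_poissonWeight k).aestronglyMeasurable)
    (integrableOn_const hfin) (fun k => ?_) ?_
  · simp only [integral_zero] at h; exact h
  · filter_upwards [ae_restrict_mem hA] with s hs
    have hs0 : (0 : ℝ) ≤ s := (hA0 hs).le
    rw [Real.norm_of_nonneg (poissonWeight_nonneg k hs0)]
    exact poissonWeight_le_one k hs0
  · refine Eventually.of_forall fun s => ?_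
    simpa [poissonWeight] using (FloorSemiring.tendsto_pow_div_factorial_atTop s).mul_const _

theorem poissonMass_Ioo {a : ℝ} (ha : 0 ≤ a) (k : ℕ) :
    poissonMass (Ioo 0 a) k = 1 - poissonCDF (k + 1) a := by
  rw [poissonMass, ← integral_Ioc_eq_integral_Ioo, ← intervalIntegral.integral_of_le ha,
    integral_poissonWeight]

theorem antitone_poissonMass_Ioo {a : ℝ} (ha : 0 ≤ a) : Antitone (poissonMass (Ioo 0 a)) := by
  refine antitone_nat_of_succ_le fun k => ?_
  rw [poissonMass_Ioo ha, poissonMass_Ioo ha, poissonCDF_succ (k + 1)]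
  linarith [poissonWeight_nonneg (k + 1) ha]

theorem sum_poissonMass_Ioo {a : ℝ} (ha : 0 ≤ a) (n : ℕ) :
    ∑ k ∈ Finset.range n, poissonMass (Ioo 0 a) k = poissonMin n a :=
  Finset.sum_congr rfl fun k _ => poissonMass_Ioo ha k

end mass

/-! ### Ordered eigenvalues of a diagonal operator -/

section diagonal

variable {H : Type*} [NormedAddCommGroup H] [InnerProductSpace ℂ H] {T : H →L[ℂ] H}
  {ψ : ℕ → H} {μ : ℕ → ℝ}

/-- `T` is diagonal with eigenvalues `μ` in the total orthogonal family `ψ`. -/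
structure IsDiagonal (T : H →L[ℂ] H) (ψ : ℕ → H) (μ : ℕ → ℝ) : Prop where
  ne_zero : ∀ k, ψ k ≠ 0
  orthogonal : Pairwise fun j k => inner ℂ (ψ j) (ψ k) = 0
  total : ∀ f, (∀ k, inner ℂ (ψ k) f = 0) → f = 0
  inner_apply : ∀ k f, inner ℂ (ψ k) (T f) = (μ k : ℂ) * inner ℂ (ψ k) f

namespace IsDiagonal

theorem apply_eq (h : IsDiagonal T ψ μ) (k : ℕ) : T (ψ k) = (μ k : ℂ) • ψ k := by
  rw [← sub_eq_zero]
  refine h.total _ fun j => ?_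
  rw [inner_sub_right, h.inner_apply, inner_smul_right]
  rcases eq_or_ne j k with rfl | hjk
  · simp
  · simp [h.orthogonal hjk]

/-- Subtracting the finite orthogonal expansion over `S` leaves a vector orthogonal to the whole
family, which is zero by totality. -/
theorem mem_span (h : IsDiagonal T ψ μ) {S : Finset ℕ} {f : H}
    (hf : ∀ k ∉ S, inner ℂ (ψ k) f = 0) : f ∈ Submodule.span ℂ (ψ '' S) := by
  have : f = ∑ k ∈ S, (inner ℂ (ψ k) f / inner ℂ (ψ k) (ψ k)) • ψ k := by
    rw [← sub_eq_zero]
    refine h.total _ fun j => ?_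
    rw [inner_sub_right, inner_sum]
    simp only [inner_smul_right]
    by_cases hj : j ∈ S
    · rw [Finset.sum_eq_single_of_mem j hj fun k _ hk => by rw [h.orthogonal hk.symm, mul_zero],
        div_mul_cancel₀ _ (inner_self_ne_zero.2 (h.ne_zero j)), sub_self]
    · rw [hf j hj, Finset.sum_eq_zero fun k hk => ?_, sub_self]
      rw [h.orthogonal (ne_of_mem_of_not_mem hk hj).symm, mul_zero]
  rw [this]
  exact Submodule.sum_mem _ fun k hk => Submodule.smul_mem _ _
    (Submodule.subset_span (mem_image_of_mem ψ hk))

/-- An eigenvector for `s` is orthogonal to every `ψ k` with `μ k ≠ s`, so for `s ≥ t` only indices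
in `S` can contribute. -/
theorem rank_le (h : IsDiagonal T ψ μ) {S : Finset ℕ} {t : ℝ} (hS : ∀ k ∉ S, μ k < t) :
    Module.rank ℂ (⨆ (s : ℝ) (_ : t ≤ s), Module.End.eigenspace (T : H →ₗ[ℂ] H) (s : ℂ) :
      Submodule ℂ H) ≤ S.card := by
  have hle : (⨆ (s : ℝ) (_ : t ≤ s), Module.End.eigenspace (T : H →ₗ[ℂ] H) (s : ℂ) :
      Submodule ℂ H) ≤ Submodule.span ℂ (ψ '' S) := by
    refine iSup₂_le fun s hs f hf => h.mem_span fun k hk => ?_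
    have hTf : T f = (s : ℂ) • f := Module.End.mem_eigenspace_iff.1 hf
    have h1 := h.inner_apply k f
    rw [hTf, inner_smul_right] at h1
    by_contra h2
    have := mul_right_cancel₀ h2 h1
    have : s = μ k := by exact_mod_cast this
    linarith [hS k hk]
  classical
  rw [← Finset.coe_image] at hle
  exact (Submodule.rank_mono hle).trans ((rank_span_finset_le _).trans
    (by exact_mod_cast Finset.card_image_le))

theorem le_rank (h : IsDiagonal T ψ μ) {S : Finset ℕ} {t : ℝ} (hS : ∀ k ∈ S, t ≤ μ k) :
    (S.card : Cardinal) ≤ Module.rank ℂ (⨆ (s : ℝ) (_ : t ≤ s),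
      Module.End.eigenspace (T : H →ₗ[ℂ] H) (s : ℂ) : Submodule ℂ H) := by
  have hli : LinearIndependent ℂ ψ :=
    linearIndependent_of_ne_zero_of_inner_eq_zero h.ne_zero h.orthogonal
  have hli' : LinearIndependent ℂ fun k : S => ψ k := hli.comp _ Subtype.val_injective
  have hr := rank_span hli'
  have hcard : Cardinal.mk (range fun k : S => ψ k) = S.card := by
    classical
    have : (range fun k : S => ψ k) = (S.image ψ : Finset H) := by ext; simp
    rw [this, ← Finset.card_image_of_injective S hli.injective]
    exact Cardinal.mk_coe_finset
  rw [← hcard, ← hr]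
  refine Submodule.rank_mono (Submodule.span_le.2 ?_)
  rintro _ ⟨k, rfl⟩
  exact Submodule.mem_iSup_of_mem (μ k) (Submodule.mem_iSup_of_mem (hS k k.2)
    (Module.End.mem_eigenspace_iff.2 (h.apply_eq k)))

theorem decreasingEigenvalue_eq (h : IsDiagonal T ψ μ) {S : Finset ℕ} {j : ℕ} (hj : j ∉ S)
    (hpos : 0 < μ j) (hS : ∀ k ∈ S, μ j ≤ μ k) (hS' : ∀ k ∉ S, μ k ≤ μ j) :
    decreasingEigenvalue T (S.card + 1) = μ j := by
  refine IsGreatest.csSup_eq ⟨⟨hpos, ?_⟩, ?_⟩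
  · rw [← Finset.card_insert_of_notMem hj]
    refine h.le_rank fun k hk => ?_
    rcases Finset.mem_insert.1 hk with rfl | hk
    exacts [le_rfl, hS k hk]
  · rintro t ⟨_, ht⟩
    by_contra! hlt
    have := ht.trans (h.rank_le fun k hk => (hS' k hk).trans_lt hlt)
    have : S.card + 1 ≤ S.card := by exact_mod_cast this
    omega

theorem sum_decreasingEigenvalue_eq (h : IsDiagonal T ψ μ) (hpos : ∀ k, 0 < μ k)
    (hμ : Antitone μ) (n : ℕ) :
    ∑ k ∈ Finset.Icc 1 n, decreasingEigenvalue T k = ∑ k ∈ Finset.range n, μ k := by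
  induction n with
  | zero => simp
  | succ n ih =>
    rw [Finset.sum_Icc_succ_top (by omega), ih, Finset.sum_range_succ]
    have := h.decreasingEigenvalue_eq (S := Finset.range n) (j := n) (by simp) (hpos n)
      (fun k hk => hμ (Finset.mem_range.1 hk).le)
      (fun k hk => hμ (not_lt.1 fun hlt => hk (Finset.mem_range.2 hlt)))
    rw [Finset.card_range] at this
    rw [this]

/-- The `μ k` need not be monotone in `k`, so the set is built greedily by adjoining an index that
maximises `μ` outside the current one. -/
theorem exists_sum_decreasingEigenvalue_eq (h : IsDiagonal T ψ μ) (hpos : ∀ k, 0 < μ k)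
    (hμ : Tendsto μ atTop (𝓝 0)) (n : ℕ) :
    ∃ S : Finset ℕ, S.card = n ∧ (∀ k ∈ S, ∀ j ∉ S, μ j ≤ μ k) ∧
      ∑ k ∈ Finset.Icc 1 n, decreasingEigenvalue T k = ∑ k ∈ S, μ k := by
  induction n with
  | zero => exact ⟨∅, by simp⟩
  | succ n ih =>
    obtain ⟨S, hcard, hS, hsum⟩ := ih
    obtain ⟨i, hi⟩ := Infinite.exists_notMem_finset S
    obtain ⟨j, hj, hjmax⟩ : ∃ j ∉ S, ∀ k ∉ S, μ k ≤ μ j := by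
      -- The maximum is attained: as `μ` tends to zero, only finitely many indices do as well as the
      -- reference index `i`.
      have hfin : {k | μ i ≤ μ k}.Finite := by
        have := hμ.eventually (gt_mem_nhds (hpos i))
        rw [← Nat.cofinite_eq_atTop, eventually_cofinite] at this
        simpa using this
      obtain ⟨j, hj, hjmax⟩ := (hfin.inter_of_left (↑S)ᶜ).exists_maximalFor μ _ ⟨i, le_refl (μ i), hi⟩
      refine ⟨j, hj.2, fun k hk => ?_⟩
      rcases le_total (μ i) (μ k) with hik | hik
      · rcases le_total (μ k) (μ j) with h' | h'
        exacts [h', hjmax ⟨hik, hk⟩ h']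
      · exact hik.trans hj.1
    refine ⟨insert j S, by rw [Finset.card_insert_of_notMem hj, hcard], ?_, ?_⟩
    · intro k hk l hl
      rw [Finset.mem_insert, not_or] at hl
      rcases Finset.mem_insert.1 hk with rfl | hk
      exacts [hjmax l hl.2, hS k hk l hl.2]
    · rw [Finset.sum_Icc_succ_top (by omega), Finset.sum_insert hj, hsum, ← hcard,
        h.decreasingEigenvalue_eq hj (hpos j) (fun k hk => hS k hk j hj) hjmax, add_comm]

end IsDiagonal

end diagonal

/-! ### Inner products with translated monomials -/

theorem integral_eq_integral_polar {f : ℂ → ℂ} (hm : Measurable f) (hf : Integrable f) :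
    ∫ z, f z = ∫ r in Ioi (0 : ℝ), ∫ θ in Ioo (-Real.pi) Real.pi, r • f (circleMap 0 r θ) := by
  have e : ∀ p : ℝ × ℝ, Complex.polarCoord.symm p = circleMap 0 p.1 p.2 := fun p => by
    simp [circleMap, Complex.exp_mul_I]
  rw [← Complex.integral_comp_polarCoord_symm, polarCoord_target, Measure.volume_eq_prod,
    setIntegral_prod]
  · simp only [e]
  rw [← Measure.volume_eq_prod, ← polarCoord_target]
  simp only [e]
  refine ⟨Measurable.aestronglyMeasurable ?_, ?_⟩
  · refine measurable_fst.smul (hm.comp ?_)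
    simp only [circleMap]; fun_prop
  · have h := hf.hasFiniteIntegral
    rw [hasFiniteIntegral_iff_enorm, ← Complex.lintegral_comp_polarCoord_symm] at h
    rw [hasFiniteIntegral_iff_enorm]
    convert! h using 1
    refine setLIntegral_congr_fun polarCoord.open_target.measurableSet fun p hp => ?_
    have hp0 : 0 ≤ p.1 := by
      rw [polarCoord_target] at hp; exact le_of_lt hp.1
    rw [e, smul_eq_mul, enorm_smul, Real.enorm_of_nonneg hp0]

/-- On the circle `ū = r²/u`, which turns the integral into Cauchy's formula for the `k`-th
derivative at `w`. -/
theorem integral_conj_circleMap_pow_mul {G : ℂ → ℂ} (hG : Differentiable ℂ G) (w : ℂ) (k : ℕ)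
    {r : ℝ} (hr : 0 < r) :
    ∫ θ in Ioo (-Real.pi) Real.pi,
      (starRingEnd ℂ) (circleMap 0 r θ) ^ k * G (circleMap 0 r θ + w) =
    (r : ℂ) ^ (2 * k) * (2 * Real.pi / k.factorial * iteratedDeriv k G w) := by
  have hC := hG.differentiableOn.circleIntegral_one_div_sub_center_pow_smul
    (c := w) hr k
  have hp : Function.Periodic (fun θ => (starRingEnd ℂ) (circleMap 0 r θ) ^ k *
      G (circleMap 0 r θ + w)) (2 * Real.pi) :=
    (periodic_circleMap 0 r).comp fun u => (starRingEnd ℂ) u ^ k * G (u + w)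
  have hshift := hp.intervalIntegral_add_eq (-Real.pi) 0
  rw [zero_add, show -Real.pi + 2 * Real.pi = Real.pi by ring] at hshift
  rw [← integral_Ioc_eq_integral_Ioo,
    ← intervalIntegral.integral_of_le (by linarith [Real.pi_pos]), hshift]
  have hpt : ∀ θ : ℝ, (starRingEnd ℂ) (circleMap 0 r θ) ^ k * G (circleMap 0 r θ + w) =
      (r : ℂ) ^ (2 * k) * -Complex.I * (deriv (circleMap w r) θ •
        ((1 / (circleMap w r θ - w) ^ (k + 1)) • G (circleMap w r θ))) := fun θ => by
    have hu : circleMap 0 r θ ≠ 0 := circleMap_ne_center hr.ne'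
    have h1 : circleMap w r θ = circleMap 0 r θ + w := by simp [circleMap, add_comm]
    have h2 : (starRingEnd ℂ) (circleMap 0 r θ) = (r : ℂ) ^ 2 / circleMap 0 r θ := by
      rw [eq_div_iff hu, mul_comm, Complex.mul_conj, Complex.normSq_eq_norm_sq]
      simp
    rw [deriv_circleMap, h1, h2, add_sub_cancel_right, smul_eq_mul, smul_eq_mul, div_pow, ← pow_mul,
      pow_succ]
    field_simp
    rw [Complex.I_sq]; ring
  simp only [hpt]
  rw [intervalIntegral.integral_const_mul]
  rw [circleIntegral] at hC
  rw [hC, smul_eq_mul]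
  linear_combination ((r : ℂ) ^ (2 * k) * (2 * Real.pi / k.factorial * iteratedDeriv k G w)) *
    (-1 : ℂ) * Complex.I_sq

/-- The translate to `w` of the `k`-th monomial in the Fock space, up to normalization. -/
noncomputable def fockMonomial (w : ℂ) (k : ℕ) (z : ℂ) : ℂ :=
  (z - w) ^ k * Complex.exp (Real.pi * (starRingEnd ℂ) w * z)

theorem differentiable_fockMonomial (w : ℂ) (k : ℕ) : Differentiable ℂ (fockMonomial w k) := by
  unfold fockMonomial; fun_prop

/-- The holomorphic factor of an entire function relative to the exponential at `w`. -/
noncomputable def fockFactor (w : ℂ) (F : ℂ → ℂ) (z : ℂ) : ℂ :=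
  Complex.exp (-(Real.pi * (starRingEnd ℂ) w * z)) * F z

theorem differentiable_fockFactor (w : ℂ) {F : ℂ → ℂ} (hF : Differentiable ℂ F) :
    Differentiable ℂ (fockFactor w F) := by
  unfold fockFactor; fun_prop

theorem fockFactor_fockMonomial (w : ℂ) (k : ℕ) :
    fockFactor w (fockMonomial w k) = fun z => (z - w) ^ k := by
  ext z
  rw [fockFactor, fockMonomial, mul_left_comm, ← Complex.exp_add, neg_add_cancel, Complex.exp_zero,
    mul_one]

/-- Completing the square, `-|z|² + w z̄ = |w|² - |z - w|² - w̄ z`: the weight becomes radial about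
`w` and the leftover exponential is entire. -/
theorem exp_mul_conj_fockMonomial_mul (w : ℂ) (k : ℕ) (F : ℂ → ℂ) (z : ℂ) :
    (Real.exp (-Real.pi * ‖z‖ ^ 2) : ℂ) * ((starRingEnd ℂ) (fockMonomial w k z) * F z) =
      Real.exp (Real.pi * ‖w‖ ^ 2) * (Real.exp (-Real.pi * ‖z - w‖ ^ 2) *
        ((starRingEnd ℂ) (z - w) ^ k * fockFactor w F z)) := by
  have h : (-Real.pi * ‖z‖ ^ 2 : ℂ) + (starRingEnd ℂ) (Real.pi * (starRingEnd ℂ) w * z) =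
      Real.pi * ‖w‖ ^ 2 + -Real.pi * ‖z - w‖ ^ 2 + -(Real.pi * (starRingEnd ℂ) w * z) := by
    simp only [← Complex.mul_conj', map_mul, map_sub, Complex.conj_conj, Complex.conj_ofReal]
    ring
  have h' := congrArg Complex.exp h
  rw [Complex.exp_add, Complex.exp_add, Complex.exp_add, Complex.exp_conj] at h'
  rw [fockMonomial, fockFactor]
  push_cast
  rw [map_mul, map_pow]
  linear_combination ((starRingEnd ℂ) (z - w) ^ k * F z) * h'

theorem measurable_gaussDensity :
    Measurable fun z : ℂ => ENNReal.ofReal (Real.exp (-Real.pi * ‖z‖ ^ 2)) := by fun_prop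

theorem integral_gaussMeasure (f : ℂ → ℂ) :
    ∫ z, f z ∂gaussMeasure = ∫ z, (Real.exp (-Real.pi * ‖z‖ ^ 2) : ℂ) * f z := by
  rw [gaussMeasure, integral_withDensity_eq_integral_toReal_smul measurable_gaussDensity
    (by simp)]
  refine integral_congr_ae (Eventually.of_forall fun z => ?_)
  simp only [ENNReal.toReal_ofReal (Real.exp_nonneg _), Complex.real_smul]

theorem integrable_gaussMeasure_iff {f : ℂ → ℂ} : Integrable f gaussMeasure ↔
    Integrable fun z => (Real.exp (-Real.pi * ‖z‖ ^ 2) : ℂ) * f z := by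
  rw [gaussMeasure, integrable_withDensity_iff_integrable_smul' measurable_gaussDensity
    (by simp)]
  simp only [ENNReal.toReal_ofReal (Real.exp_nonneg _), Complex.real_smul]

theorem integrable_norm_pow_mul_exp (k : ℕ) :
    Integrable fun z : ℂ => ‖z‖ ^ (2 * k) * Real.exp (-Real.pi * ‖z‖ ^ 2) := by
  have h := Complex.integral_rpow_mul_exp_neg_mul_rpow (p := 2) (q := (2 * k : ℕ)) (b := Real.pi)
    (by norm_num) (by have : (0:ℝ) ≤ (2 * k : ℕ) := by positivity
                      linarith) Real.pi_pos
  simp only [Real.rpow_natCast, Real.rpow_ofNat] at h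
  -- A non-integrable function has integral zero by convention, whereas the Gamma value is positive.
  by_contra hn
  rw [integral_undef hn] at h
  have h1 : 0 < Real.Gamma (((2 * k : ℕ) + 2) / 2 : ℝ) := Real.Gamma_pos_of_pos (by positivity)
  have h2 : 0 < 2 * Real.pi / 2 * Real.pi ^ (-((2 * k : ℕ) + 2) / 2 : ℝ) *
    Real.Gamma (((2 * k : ℕ) + 2) / 2 : ℝ) := by positivity
  exact h2.ne h

theorem memLp_fockMonomial (w : ℂ) (k : ℕ) : MemLp (fockMonomial w k) 2 gaussMeasure := by
  have hc : Continuous (fockMonomial w k) := (differentiable_fockMonomial w k).continuous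
  rw [memLp_two_iff_integrable_sq_norm hc.aestronglyMeasurable, gaussMeasure,
    integrable_withDensity_iff_integrable_smul' measurable_gaussDensity (by simp)]
  refine (((integrable_norm_pow_mul_exp k).comp_sub_right w).const_mul
    (Real.exp (Real.pi * ‖w‖ ^ 2))).congr (Eventually.of_forall fun z => ?_)
  have h := exp_mul_conj_fockMonomial_mul w k (fockMonomial w k) z
  rw [fockFactor_fockMonomial, ← mul_pow, Complex.conj_mul', Complex.conj_mul'] at h
  simp only [ENNReal.toReal_ofReal (Real.exp_nonneg _), smul_eq_mul]
  have h' : Real.exp (-Real.pi * ‖z‖ ^ 2) * ‖fockMonomial w k z‖ ^ 2 =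
      Real.exp (Real.pi * ‖w‖ ^ 2) * (Real.exp (-Real.pi * ‖z - w‖ ^ 2) * (‖z - w‖ ^ 2) ^ k) := by
    exact_mod_cast h
  rw [h']
  ring

/-- The radial moment `∫_B r^{2k+1} e^{-πr²} dr`. -/
noncomputable def radialMoment (B : Set ℝ) (k : ℕ) : ℝ :=
  ∫ r in Ioi (0 : ℝ), B.indicator (fun r => r ^ (2 * k + 1) * Real.exp (-Real.pi * r ^ 2)) r

/-- Integrating over each circle about `w` extracts the same Taylor coefficient for all radii, so
the set enters only through a scalar radial factor. This is the source of the diagonal form. -/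
theorem integral_indicator_conj_fockMonomial_mul {F : ℂ → ℂ} (hF : Differentiable ℂ F)
    (hF2 : MemLp F 2 gaussMeasure) (w : ℂ) (k : ℕ) {B : Set ℝ} (hB : MeasurableSet B) :
    ∫ z, {z : ℂ | ‖z - w‖ ∈ B}.indicator
      (fun z => (starRingEnd ℂ) (fockMonomial w k z) * F z) z ∂gaussMeasure =
    (Real.exp (Real.pi * ‖w‖ ^ 2) * (2 * Real.pi / k.factorial)) * radialMoment B k *
      iteratedDeriv k (fockFactor w F) w := by
  set D : Set ℂ := {u : ℂ | ‖u‖ ∈ B} with hD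
  have hDm : MeasurableSet D := measurable_norm hB
  set g : ℂ → ℂ := D.indicator fun u => Real.exp (-Real.pi * ‖u‖ ^ 2) *
    ((starRingEnd ℂ) u ^ k * fockFactor w F (u + w)) with hg
  have hgc : Continuous fun u : ℂ => (Real.exp (-Real.pi * ‖u‖ ^ 2) : ℂ) *
      ((starRingEnd ℂ) u ^ k * fockFactor w F (u + w)) := by
    have := (differentiable_fockFactor w hF).continuous
    have h2 : Continuous fun u : ℂ => (starRingEnd ℂ) u := Complex.continuous_conj
    fun_prop
  have hpt : ∀ z, (Real.exp (-Real.pi * ‖z‖ ^ 2) : ℂ) * {z : ℂ | ‖z - w‖ ∈ B}.indicator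
      (fun z => (starRingEnd ℂ) (fockMonomial w k z) * F z) z =
      Real.exp (Real.pi * ‖w‖ ^ 2) * g (z - w) := fun z => by
    by_cases hz : ‖z - w‖ ∈ B
    · rw [indicator_of_mem (show z ∈ {z : ℂ | ‖z - w‖ ∈ B} from hz), hg,
        indicator_of_mem (show z - w ∈ D from hz), exp_mul_conj_fockMonomial_mul,
        sub_add_cancel]
    · rw [indicator_of_notMem (show z ∉ {z : ℂ | ‖z - w‖ ∈ B} from hz), hg,
        indicator_of_notMem (show z - w ∉ D from hz), mul_zero, mul_zero]
  have hgi : Integrable g := by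
    refine Integrable.indicator ?_ hDm
    have h1 : Integrable (fun z => (starRingEnd ℂ) (fockMonomial w k z) * F z) gaussMeasure :=
      (memLp_fockMonomial w k).star.integrable_mul hF2
    rw [integrable_gaussMeasure_iff] at h1
    simp only [exp_mul_conj_fockMonomial_mul] at h1
    have h2 := (h1.comp_add_right w).const_mul (Real.exp (Real.pi * ‖w‖ ^ 2) : ℂ)⁻¹
    refine h2.congr (Eventually.of_forall fun u => ?_)
    have : (Real.exp (Real.pi * ‖w‖ ^ 2) : ℂ) ≠ 0 := by
      exact_mod_cast (Real.exp_pos _).ne'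
    simp only [add_sub_cancel_right]
    rw [inv_mul_cancel_left₀ this]
  rw [integral_gaussMeasure]
  simp only [hpt]
  rw [integral_const_mul, integral_sub_right_eq_self g w,
    integral_eq_integral_polar (hgc.measurable.indicator hDm) hgi]
  have hin : ∀ r ∈ Ioi (0 : ℝ), ∫ θ in Ioo (-Real.pi) Real.pi, r • g (circleMap 0 r θ) =
      ((B.indicator (fun r => r ^ (2 * k + 1) * Real.exp (-Real.pi * r ^ 2)) r : ℝ) : ℂ) *
        (2 * Real.pi / k.factorial * iteratedDeriv k (fockFactor w F) w) := by
    intro r hr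
    have hr0 : (0 : ℝ) < r := hr
    have hn : ∀ θ, ‖circleMap 0 r θ‖ = r := fun θ => by simp [abs_of_pos hr0]
    by_cases hrB : r ∈ B
    · have : ∀ θ, r • g (circleMap 0 r θ) = (r * Real.exp (-Real.pi * r ^ 2) : ℂ) *
          ((starRingEnd ℂ) (circleMap 0 r θ) ^ k * fockFactor w F (circleMap 0 r θ + w)) :=
        fun θ => by
          rw [hg, indicator_of_mem (show circleMap 0 r θ ∈ D by rwa [hD, mem_ofPred_eq, hn]), hn,
            Complex.real_smul, mul_assoc]
      simp only [this]
      rw [integral_const_mul, integral_conj_circleMap_pow_mul (differentiable_fockFactor w hF) w k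
        hr0, indicator_of_mem hrB]
      push_cast
      ring
    · have : ∀ θ, r • g (circleMap 0 r θ) = 0 := fun θ => by
        rw [hg, indicator_of_notMem (show circleMap 0 r θ ∉ D by rwa [hD, mem_ofPred_eq, hn]),
          smul_zero]
      simp [this, hrB]
  rw [setIntegral_congr_fun measurableSet_Ioi hin, integral_mul_const, integral_complex_ofReal,
    radialMoment]
  ring

/-! ### The area variable and diagonalisation of the Toeplitz operator -/

/-- The set of areas `πr²` for radii `r` in `B`. -/
def areaSet (B : Set ℝ) : Set ℝ := {s | 0 < s ∧ Real.sqrt (s / Real.pi) ∈ B}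

theorem measurableSet_areaSet {B : Set ℝ} (hB : MeasurableSet B) : MeasurableSet (areaSet B) := by
  have : Measurable fun s : ℝ => Real.sqrt (s / Real.pi) := by fun_prop
  exact measurableSet_Ioi.inter (this hB)

theorem areaSet_subset (B : Set ℝ) : areaSet B ⊆ Ioi 0 := fun _ h => h.1

theorem areaSet_univ : areaSet univ = Ioi 0 := by ext; simp [areaSet]

theorem mem_areaSet_iff {B : Set ℝ} {r : ℝ} (hr : 0 < r) : Real.pi * r ^ 2 ∈ areaSet B ↔ r ∈ B := by
  have : 0 < Real.pi * r ^ 2 := by positivity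
  rw [areaSet, mem_ofPred_eq, mul_div_cancel_left₀ _ Real.pi_ne_zero, Real.sqrt_sq hr.le]
  exact and_iff_right this

theorem radialMoment_eq {B : Set ℝ} (hB : MeasurableSet B) (k : ℕ) :
    radialMoment B k = k.factorial / (2 * Real.pi ^ (k + 1)) * poissonMass (areaSet B) k := by
  -- The substitution `s = πr²` is made in two moves, squaring and then scaling by `π`.
  have h1 := integral_comp_rpow_Ioi
    (fun x => (areaSet B).indicator (poissonWeight k) (Real.pi * x)) (two_ne_zero (α := ℝ))
  have h2 := integral_comp_mul_left_Ioi ((areaSet B).indicator (poissonWeight k)) 0 Real.pi_pos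
  rw [mul_zero, setIntegral_indicator (measurableSet_areaSet hB),
    inter_eq_right.2 (areaSet_subset B)] at h2
  rw [h2] at h1
  have h3 : ∀ r ∈ Ioi (0 : ℝ), B.indicator
      (fun r => r ^ (2 * k + 1) * Real.exp (-Real.pi * r ^ 2)) r =
      k.factorial / (2 * Real.pi ^ k) * ((|2| * r ^ ((2 : ℝ) - 1)) •
        (areaSet B).indicator (poissonWeight k) (Real.pi * r ^ (2 : ℝ))) := by
    intro r hr
    have hr0 : (0 : ℝ) < r := hr
    rw [Real.rpow_ofNat, show (2 : ℝ) - 1 = 1 by norm_num, Real.rpow_one]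
    by_cases hrB : r ∈ B
    · rw [indicator_of_mem hrB, indicator_of_mem ((mem_areaSet_iff hr0).2 hrB), poissonWeight,
        smul_eq_mul, mul_pow, abs_of_pos two_pos, neg_mul]
      field_simp
      ring
    · rw [indicator_of_notMem hrB, indicator_of_notMem (mt (mem_areaSet_iff hr0).1 hrB)]
      simp
  rw [radialMoment, setIntegral_congr_fun measurableSet_Ioi h3, integral_const_mul, h1,
    poissonMass, smul_eq_mul, pow_succ]
  field_simp

theorem poissonMass_Ioi (k : ℕ) : poissonMass (Ioi 0) k = 1 := by
  have h := Real.Gamma_eq_integral (s := k + 1) (by positivity)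
  rw [Real.Gamma_nat_eq_factorial] at h
  have : ∀ s ∈ Ioi (0 : ℝ), poissonWeight k s =
      (k.factorial : ℝ)⁻¹ * (Real.exp (-s) * s ^ ((k : ℝ) + 1 - 1)) := fun s _ => by
    rw [add_sub_cancel_right, Real.rpow_natCast, poissonWeight]; ring
  rw [poissonMass, setIntegral_congr_fun measurableSet_Ioi this, integral_const_mul, ← h]
  exact inv_mul_cancel₀ (by positivity)

/-- The monomials at `w` as elements of the Fock space. -/
noncomputable def fockBasis (w : ℂ) (k : ℕ) : fockSpace :=
  ⟨(memLp_fockMonomial w k).toLp, fockMonomial w k, differentiable_fockMonomial w k,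
    (memLp_fockMonomial w k).coeFn_toLp⟩

theorem coeFn_fockBasis (w : ℂ) (k : ℕ) :
    (fockBasis w k : Lp ℂ 2 gaussMeasure) =ᵐ[gaussMeasure] fockMonomial w k :=
  (memLp_fockMonomial w k).coeFn_toLp

/-- The squared norm of the `k`-th monomial at `w`. -/
noncomputable def fockConst (w : ℂ) (k : ℕ) : ℝ :=
  Real.exp (Real.pi * ‖w‖ ^ 2) * (2 * Real.pi / k.factorial) *
    (k.factorial / (2 * Real.pi ^ (k + 1)))

theorem fockConst_pos (w : ℂ) (k : ℕ) : 0 < fockConst w k := by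
  unfold fockConst; positivity

theorem inner_fockBasis_toeplitz {Ω : Set ℂ} (hΩ : NullMeasurableSet Ω volume) {w : ℂ} {B : Set ℝ}
    (hB : MeasurableSet B) (hΩB : Ω =ᵐ[volume] {z : ℂ | ‖z - w‖ ∈ B}) {f : fockSpace} {F : ℂ → ℂ}
    (hF : Differentiable ℂ F) (hfF : (f : Lp ℂ 2 gaussMeasure) =ᵐ[gaussMeasure] F) (k : ℕ) :
    inner ℂ (fockBasis w k) (toeplitz Ω hΩ f) =
      fockConst w k * poissonMass (areaSet B) k * iteratedDeriv k (fockFactor w F) w := by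
  have hF2 : MemLp F 2 gaussMeasure := (memLp_congr_ae hfF).1 (Lp.memLp _)
  have h := integral_indicator_conj_fockMonomial_mul hF hF2 w k hB
  rw [radialMoment_eq hB] at h
  have h2 : inner ℂ (fockBasis w k) (toeplitz Ω hΩ f) =
      inner ℂ (fockBasis w k : Lp ℂ 2 gaussMeasure) (mulIndicator Ω hΩ f) :=
    Submodule.inner_orthogonalProjectionOnto_eq_of_mem_left _ _
  rw [h2, L2.inner_def, fockConst]
  push_cast at h ⊢
  rw [← mul_assoc] at h
  rw [← h]
  refine integral_congr_ae ?_
  filter_upwards [coeFn_fockBasis w k, hfF, (memLp_indicator hΩ (f : Lp ℂ 2 gaussMeasure)).coeFn_toLp,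
    gaussMeasure_absolutelyContinuous.ae_eq hΩB] with z h1 h2 h3 h4
  have h3' : (mulIndicator Ω hΩ f : Lp ℂ 2 gaussMeasure) z =
    Ω.indicator (f : Lp ℂ 2 gaussMeasure) z := h3
  have h4' : z ∈ Ω ↔ z ∈ {z : ℂ | ‖z - w‖ ∈ B} := Iff.of_eq h4
  rw [RCLike.inner_apply, h1, h3', mul_comm]
  by_cases hz : z ∈ Ω
  · rw [indicator_of_mem hz, indicator_of_mem (h4'.1 hz), h2]
  · rw [indicator_of_notMem hz, indicator_of_notMem (mt h4'.2 hz), mul_zero]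

theorem toeplitz_univ (f : fockSpace) : toeplitz univ MeasurableSet.univ.nullMeasurableSet f = f := by
  have : mulIndicator univ MeasurableSet.univ.nullMeasurableSet (f : Lp ℂ 2 gaussMeasure) = f := by
    refine Lp.ext ?_
    filter_upwards [(memLp_indicator MeasurableSet.univ.nullMeasurableSet
      (f : Lp ℂ 2 gaussMeasure)).coeFn_toLp] with z hz
    exact hz.trans (by rw [indicator_univ])
  change fockSpace.orthogonalProjectionOnto (mulIndicator univ
    MeasurableSet.univ.nullMeasurableSet (f : Lp ℂ 2 gaussMeasure)) = f
  rw [this]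
  exact Submodule.orthogonalProjectionOnto_mem_subspace_eq_self f

/-- This is the case `Ω = ℂ` of the Toeplitz formula, where the operator is the identity and every
Poisson mass is one. -/
theorem inner_fockBasis {w : ℂ} {f : fockSpace} {F : ℂ → ℂ}
    (hF : Differentiable ℂ F) (hfF : (f : Lp ℂ 2 gaussMeasure) =ᵐ[gaussMeasure] F) (k : ℕ) :
    inner ℂ (fockBasis w k) f = fockConst w k * iteratedDeriv k (fockFactor w F) w := by
  have h := inner_fockBasis_toeplitz MeasurableSet.univ.nullMeasurableSet (w := w)
    MeasurableSet.univ (by simp) hF hfF k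
  rwa [toeplitz_univ, areaSet_univ, poissonMass_Ioi, Complex.ofReal_one, mul_one] at h

theorem inner_fockBasis_fockBasis (w : ℂ) (j k : ℕ) : inner ℂ (fockBasis w j) (fockBasis w k) =
    fockConst w j * (if j = k then k.factorial else 0 : ℕ) := by
  rw [inner_fockBasis (differentiable_fockMonomial w k) (coeFn_fockBasis w k),
    fockFactor_fockMonomial, iteratedDeriv_comp_sub_const j (fun z => z ^ k)]
  simp only [sub_self]
  rw [iteratedDeriv_fun_pow_zero]

/-- The formulas for `⟨ψ_k, T f⟩` and `⟨ψ_k, f⟩` differ only by the factor `poissonMass`. Totality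
holds because orthogonality to every `ψ_k` kills all Taylor coefficients at `w` of an entire
function. -/
theorem isDiagonal_toeplitz {Ω : Set ℂ} (hΩ : NullMeasurableSet Ω volume) {w : ℂ} {B : Set ℝ}
    (hB : MeasurableSet B) (hΩB : Ω =ᵐ[volume] {z : ℂ | ‖z - w‖ ∈ B}) :
    IsDiagonal (toeplitz Ω hΩ) (fockBasis w) (poissonMass (areaSet B)) where
  ne_zero k h0 := by
    have h := inner_fockBasis_fockBasis w k k
    rw [h0, inner_zero_left, if_pos rfl] at h
    have h1 : (fockConst w k : ℂ) ≠ 0 := by exact_mod_cast (fockConst_pos w k).ne'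
    have h2 : ((k.factorial : ℕ) : ℂ) ≠ 0 := by exact_mod_cast k.factorial_ne_zero
    exact mul_ne_zero h1 h2 h.symm
  orthogonal j k hjk := by
    beta_reduce
    rw [inner_fockBasis_fockBasis, if_neg hjk, Nat.cast_zero, mul_zero]
  total f hf := by
    obtain ⟨F, hF, hfF⟩ := f.2
    have hd : ∀ k, iteratedDeriv k (fockFactor w F) w = 0 := fun k => by
      have h := hf k
      rw [inner_fockBasis hF hfF] at h
      exact (mul_eq_zero.1 h).resolve_left (by exact_mod_cast (fockConst_pos w k).ne')
    have h0 : ∀ z, F z = 0 := fun z => by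
      have h := Complex.taylorSeries_eq_of_entire' w z (differentiable_fockFactor w hF)
      simp only [hd, mul_zero, zero_mul, tsum_zero] at h
      exact (mul_eq_zero.1 h.symm).resolve_left (Complex.exp_ne_zero _)
    refine Subtype.ext (Lp.ext ?_)
    filter_upwards [hfF, Lp.coeFn_zero ℂ 2 gaussMeasure] with z h1 h2
    exact (h1.trans (h0 z)).trans h2.symm
  inner_apply k f := by
    obtain ⟨F, hF, hfF⟩ := f.2
    rw [inner_fockBasis_toeplitz hΩ hB hΩB hF hfF, inner_fockBasis hF hfF]
    ring

/-! ### The area map preserves measure -/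

theorem pi_mul_sq_lt_iff {r b : ℝ} (hr : 0 ≤ r) :
    Real.pi * r ^ 2 < b ↔ r < Real.sqrt (b / Real.pi) := by
  rw [Real.lt_sqrt hr, lt_div_iff₀ Real.pi_pos, mul_comm]

theorem volume_ball_sqrt (w : ℂ) (b : ℝ) :
    volume (Metric.ball w (Real.sqrt (b / Real.pi))) = ENNReal.ofReal b := by
  rcases le_total b 0 with hb | hb
  · rw [Real.sqrt_eq_zero_of_nonpos (div_nonpos_of_nonpos_of_nonneg hb Real.pi_pos.le)]
    simp [ENNReal.ofReal_of_nonpos hb]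
  · rw [Complex.volume_ball, ← ENNReal.ofReal_pow (Real.sqrt_nonneg _),
      Real.sq_sqrt (by positivity), ← ENNReal.ofReal_coe_nnreal, ← ENNReal.ofReal_mul (by positivity),
      NNReal.coe_real_pi, div_mul_cancel₀ _ Real.pi_ne_zero]

/-- The centre must be discarded: for `a < 0` the square root is zero and the closed ball is `{w}`,
although `w` may lie in the preimage. -/
theorem preimage_Ioo_ae_eq (w : ℂ) (a b : ℝ) :
    (fun z : ℂ => Real.pi * ‖z - w‖ ^ 2) ⁻¹' Ioo a b =ᵐ[volume]
      (Metric.ball w (Real.sqrt (b / Real.pi)) \ Metric.closedBall w (Real.sqrt (a / Real.pi)) :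
        Set ℂ) := by
  refine eventuallyEq_set.2 ?_
  filter_upwards [Measure.ae_ne volume w] with z hz
  have hpos : 0 < ‖z - w‖ := norm_pos_iff.2 (sub_ne_zero.2 hz)
  change (a < Real.pi * ‖z - w‖ ^ 2 ∧ Real.pi * ‖z - w‖ ^ 2 < b) ↔ _
  rw [Set.mem_sdiff, mem_ball_iff_norm, mem_closedBall_iff_norm, not_le, and_comm,
    pi_mul_sq_lt_iff hpos.le, Real.sqrt_lt' hpos, div_lt_iff₀ Real.pi_pos, mul_comm Real.pi]

theorem measurePreserving_pi_mul_norm_sq (w : ℂ) :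
    MeasurePreserving (fun z : ℂ => Real.pi * ‖z - w‖ ^ 2) volume (volume.restrict (Ioi 0)) := by
  have hm : Measurable fun z : ℂ => Real.pi * ‖z - w‖ ^ 2 := by fun_prop
  refine ⟨hm, (Real.measure_ext_Ioo_rat fun a b => ?_).symm⟩
  rw [Measure.map_apply hm measurableSet_Ioo, measure_congr (preimage_Ioo_ae_eq w a b),
    Measure.restrict_apply measurableSet_Ioo, inter_comm, Ioi_inter_Ioo, Real.volume_Ioo]
  have hmax : ENNReal.ofReal (0 ⊔ a : ℝ) = ENNReal.ofReal a := by
    rcases le_total (a : ℝ) 0 with h | h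
    · rw [max_eq_left h, ENNReal.ofReal_zero, ENNReal.ofReal_of_nonpos h]
    · rw [max_eq_right h]
  rw [ENNReal.ofReal_sub _ (le_max_left _ _), hmax]
  have hcl : volume (Metric.closedBall w (Real.sqrt ((a : ℝ) / Real.pi))) =
      ENNReal.ofReal a := by
    rw [Complex.volume_closedBall, ← Complex.volume_ball w, volume_ball_sqrt]
  rcases le_or_gt (b : ℝ) (0 ⊔ a) with hab | hab
  · have : Metric.ball w (Real.sqrt ((b : ℝ) / Real.pi)) ⊆
        Metric.closedBall w (Real.sqrt ((a : ℝ) / Real.pi)) := by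
      refine Metric.ball_subset_closedBall.trans (Metric.closedBall_subset_closedBall ?_)
      rcases le_max_iff.1 hab with h | h
      · rw [Real.sqrt_eq_zero_of_nonpos (div_nonpos_of_nonpos_of_nonneg h Real.pi_pos.le)]
        exact Real.sqrt_nonneg _
      · gcongr
    rw [sdiff_eq_empty.2 this, measure_empty, ← hmax,
      tsub_eq_zero_of_le (ENNReal.ofReal_le_ofReal hab)]
  · have hb : 0 < (b : ℝ) := (le_max_left _ _).trans_lt hab
    have : Metric.closedBall w (Real.sqrt ((a : ℝ) / Real.pi)) ⊆
        Metric.ball w (Real.sqrt ((b : ℝ) / Real.pi)) := by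
      refine Metric.closedBall_subset_ball ?_
      rw [Real.sqrt_lt' (Real.sqrt_pos.2 (div_pos hb Real.pi_pos)),
        Real.sq_sqrt (div_pos hb Real.pi_pos).le]
      exact div_lt_div_of_pos_right ((le_max_right _ _).trans_lt hab) Real.pi_pos
    rw [measure_sdiff this Metric.isClosed_closedBall.measurableSet.nullMeasurableSet (by simp [hcl]),
      hcl, volume_ball_sqrt]

theorem preimage_areaSet_ae_eq (w : ℂ) (B : Set ℝ) :
    (fun z : ℂ => Real.pi * ‖z - w‖ ^ 2) ⁻¹' areaSet B =ᵐ[volume] {z : ℂ | ‖z - w‖ ∈ B} := by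
  refine eventuallyEq_set.2 ?_
  filter_upwards [Measure.ae_ne volume w] with z hz
  exact mem_areaSet_iff (norm_pos_iff.2 (sub_ne_zero.2 hz))

theorem volume_norm_sub_mem (w : ℂ) {B : Set ℝ} (hB : MeasurableSet B) :
    volume {z : ℂ | ‖z - w‖ ∈ B} = volume (areaSet B) := by
  rw [← measure_congr (preimage_areaSet_ae_eq w B),
    (measurePreserving_pi_mul_norm_sq w).measure_preimage (measurableSet_areaSet hB).nullMeasurableSet,
    Measure.restrict_apply (measurableSet_areaSet hB), inter_eq_left.2 (areaSet_subset B)]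

/-- The map `r ↦ πr²` is differentiable, hence sends null sets to null sets, and the area map pulls
these back to null sets of the plane. -/
theorem setOf_norm_sub_mem_ae_congr (w : ℂ) {E B : Set ℝ} (h : E =ᵐ[volume] B) :
    {z : ℂ | ‖z - w‖ ∈ E} =ᵐ[volume] {z : ℂ | ‖z - w‖ ∈ B} := by
  have h0 : volume ((fun r : ℝ => Real.pi * r ^ 2) '' (E ∆ B)) = 0 :=
    addHaar_image_eq_zero_of_differentiableOn_of_addHaar_eq_zero volume (by fun_prop)
      (measure_symmDiff_eq_zero_iff.2 h)
  have h1 := (measurePreserving_pi_mul_norm_sq w).quasiMeasurePreserving.preimage_null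
    (Measure.restrict_le_self.absolutelyContinuous h0)
  refine measure_symmDiff_eq_zero_iff.1 (measure_mono_null (fun z hz => ?_) h1)
  exact ⟨‖z - w‖, hz, rfl⟩

theorem ae_eq_ball_of_areaSet_ae_eq (w : ℂ) {B : Set ℝ} {a : ℝ}
    (h : areaSet B =ᵐ[volume] Ioo 0 a) :
    {z : ℂ | ‖z - w‖ ∈ B} =ᵐ[volume] Metric.ball w (Real.sqrt (a / Real.pi)) := by
  have h1 := (measurePreserving_pi_mul_norm_sq w).quasiMeasurePreserving.preimage_ae_eq
    (ae_restrict_of_ae h)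
  refine (preimage_areaSet_ae_eq w B).symm.trans (h1.trans ((preimage_Ioo_ae_eq w 0 a).trans ?_))
  refine eventuallyEq_set.2 ?_
  filter_upwards [Measure.ae_ne volume w] with z hz
  simp [hz]

theorem areaSet_Iio (a : ℝ) : areaSet (Iio (Real.sqrt (a / Real.pi))) = Ioo 0 a := by
  ext s
  refine and_congr_right fun hs => ?_
  rw [mem_Iio, Real.sqrt_lt_sqrt_iff (div_nonneg hs.le Real.pi_pos.le),
    div_lt_div_iff_of_pos_right Real.pi_pos]

/-! ### Balls and the conclusion -/

/-- For a ball the masses already decrease in `k`, so the first `n` of them are the `n` largest. The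
centre is arbitrary, so this serves both `Ω*` and the converse of the equality case. -/
theorem sum_toeplitzEigenvalue_of_ae_eq_ball {Ω : Set ℂ} (hΩ : NullMeasurableSet Ω volume) {w : ℂ}
    {a : ℝ} (ha : 0 < a) (h : Ω =ᵐ[volume] Metric.ball w (Real.sqrt (a / Real.pi))) (n : ℕ) :
    ∑ k ∈ Finset.Icc 1 n, toeplitzEigenvalue Ω hΩ k = poissonMin n a := by
  have hball : Metric.ball w (Real.sqrt (a / Real.pi)) =
      {z : ℂ | ‖z - w‖ ∈ Iio (Real.sqrt (a / Real.pi))} := by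
    ext z; simp [dist_eq_norm]
  have hd := isDiagonal_toeplitz hΩ measurableSet_Iio (hball ▸ h)
  rw [areaSet_Iio] at hd
  rw [← sum_poissonMass_Ioo ha.le, ← hd.sum_decreasingEigenvalue_eq
    (poissonMass_pos measurableSet_Ioo (fun s hs => hs.1) (by simp) (by simpa using ha))
    (antitone_poissonMass_Ioo ha.le)]
  rfl

theorem image_add_equimeasurableBall (Ω : Set ℂ) (w : ℂ) :
    (fun z => z + w) '' equimeasurableBall Ω =
      Metric.ball w (Real.sqrt ((volume Ω).toReal / Real.pi)) := by
  rw [equimeasurableBall, image_add_right]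
  ext z
  simp [dist_eq_norm, sub_eq_add_neg]

theorem theorem1p2 (Ω : Set ℂ) (hΩ : NullMeasurableSet Ω volume)
    (hsymm : IsCircularlySymmetric Ω) (hpos : 0 < volume Ω) (hfin : volume Ω ≠ ∞)
    (N : ℕ) (hN : 1 ≤ N) :
    (∑ k ∈ Finset.Icc 1 N, toeplitzEigenvalue Ω hΩ k ≤
      ∑ k ∈ Finset.Icc 1 N, toeplitzEigenvalue (equimeasurableBall Ω)
        (nullMeasurableSet_equimeasurableBall Ω) k) ∧
    (∑ k ∈ Finset.Icc 1 N, toeplitzEigenvalue (equimeasurableBall Ω)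
        (nullMeasurableSet_equimeasurableBall Ω) k =
      (N : ℝ) - ∑ k ∈ Finset.range N, ((N : ℝ) - (k : ℝ)) *
        ((volume Ω).toReal ^ k / (Nat.factorial k : ℝ)) * Real.exp (-(volume Ω).toReal)) ∧
    (∑ k ∈ Finset.Icc 1 N, toeplitzEigenvalue Ω hΩ k =
        ∑ k ∈ Finset.Icc 1 N, toeplitzEigenvalue (equimeasurableBall Ω)
          (nullMeasurableSet_equimeasurableBall Ω) k ↔
      ∃ w : ℂ, SetEquiv Ω ((fun z => z + w) '' equimeasurableBall Ω)) := by
  have ha : 0 < (volume Ω).toReal := ENNReal.toReal_pos hpos.ne' hfin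
  have hball := sum_toeplitzEigenvalue_of_ae_eq_ball (w := 0)
    (nullMeasurableSet_equimeasurableBall Ω) ha (ae_eq_refl _) N
  obtain ⟨w, E, -, hE, hΩE⟩ := hsymm
  -- Passing to a Borel set changes `Ω` only by a null set.
  obtain ⟨B, -, hB, hBE⟩ := hE.exists_measurable_superset_ae_eq
  have hΩB : Ω =ᵐ[volume] {z : ℂ | ‖z - w‖ ∈ B} := by
    rw [hΩE]; exact setOf_norm_sub_mem_ae_congr w hBE.symm
  have hvol : volume (areaSet B) = volume Ω := by
    rw [measure_congr hΩB, volume_norm_sub_mem w hB]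
  have hA := measurableSet_areaSet hB
  have hA0 := areaSet_subset B
  have hAfin : volume (areaSet B) ≠ ∞ := hvol ▸ hfin
  have hreal : volume.real (areaSet B) = (volume Ω).toReal := congrArg ENNReal.toReal hvol
  obtain ⟨S, hS, -, hsum⟩ := (isDiagonal_toeplitz hΩ hB hΩB).exists_sum_decreasingEigenvalue_eq
    (poissonMass_pos hA hA0 hAfin (hvol ▸ hpos)) (tendsto_poissonMass hA hA0 hAfin) N
  have hsum' : ∑ k ∈ Finset.Icc 1 N, toeplitzEigenvalue Ω hΩ k =
    ∑ k ∈ S, poissonMass (areaSet B) k := hsum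
  refine ⟨?_, ?_, ?_, ?_⟩
  · rw [hsum', hball, ← hS, ← hreal]
    exact sum_poissonMass_le hA hA0 hAfin S
  · rw [hball, poissonMin_eq]
  · intro heq
    rw [hsum', hball, ← hS, ← hreal] at heq
    -- Here `1 ≤ N` is what makes `S` nonempty; with an empty sum, equality would carry no
    -- information.
    have h := ae_mem_of_sum_poissonMass_eq hA hA0 hAfin
      (Finset.card_pos.1 (by omega)) heq
    rw [hreal] at h
    refine ⟨w, measure_symmDiff_eq_zero_iff.2 ?_⟩
    rw [image_add_equimeasurableBall]
    exact hΩB.trans (ae_eq_ball_of_areaSet_ae_eq w h)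
  · rintro ⟨v, hv⟩
    have h := measure_symmDiff_eq_zero_iff.1 hv
    rw [image_add_equimeasurableBall] at h
    rw [hball, sum_toeplitzEigenvalue_of_ae_eq_ball hΩ ha h]
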